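/- **Setting.** Let $\alpha\in(0,1)$, $\rho\in(0,1)$, $\theta\in(\alpha,\rho)$, $\mu_*=\min\{\rho,1-\rho\}$ and $\mu\in[0,\mu_*)$. *Kernel.* Let $W\colon(0,\infty)^2\to\mathbb R$ be continuous, symmetric and homogeneous of degree $0$ with $0\le W(x,y)\le (x/y)^\alpha+(y/x)^\alpha$. Assume that $W(\cdot,1)$ has an analytic extension, again written $W(z)$, to $\mathbb C\setminus(-\infty,0]$ with $\operatorname{Re}W(z)\ge0$ for $\operatorname{Re}z\ge0$, $W(z)=W(z^{-1})$ and $|W(z)|\le C_0(|z|^{-\alpha}+|z|^{\alpha})$, and that, on each of the open half-planes $\mathbb H_\pm=\{\pm\operatorname{Im}z>0\}$, $|W'(z)|\le C_0(|z|^{-\alpha-1}+|z|^{\alpha-1})$ and, for some $\kappa\in(0,1)$ and all $z_1,z_2$ in the same half-plane with $m:=\min\{|z_1|,|z_2|\}$ and $|z_1-z_2|\le m/2$, $$|W'(z_1)-W'(z_2)|\le C_0|z_1-z_2|^{\kappa}\begin{cases}m^{-\alpha-1-\kappa}&\text{if }m\le1,\\ m^{\alpha-1-\kappa}&\text{if }m\ge1.\end{cases}$$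 Then $W|_{\mathbb H_\pm}$ has a continuous extension $W_\pm$ to $\overline{\mathbb H}_\pm\setminus\{0\}$, and $W_+(-1)=W_-(-1)=:W(-1)$ is real. The representation kernel of $W(x,y)/(x+y)$ as a Laplace integral is the signed measure on $(0,\infty)^2$ $$\Gamma(\xi,\eta)=\frac{\varphi(\eta/\xi)}{\xi}+W(-1)\,\delta(\xi-\eta),\qquad \varphi(s)=\frac{W_-(-s)-W_+(-s)}{2\pi i\,(1-s)}$$ ($\varphi$ extended continuously to $s=1$). *Bilinear form.* For functions $G,H$ on $[0,\infty)$ put $$N[G,H](r)=\frac1r\int_0^\infty\!\!\int_0^\infty\Gamma(\xi,\eta)\Big(G''(r+\xi)\big(H(\eta)-H(\eta+r)\big)+G'(r+\xi)\big(H'(\eta)-H'(\eta+r)\big)\Big)\,d\xi\,d\eta,$$ $$\mathcal B_W(G,H)(q)=\int_q^\infty\!\int_p^\infty N[G,H](r)\,dr\,dp .$$ *Spaces.* For $\nu\ge0$ and $\chi>0$ let $X^2_{\nu,\chi}$ be the space of real-valued $G\in C^2((0,\infty))\cap C([0,\infty))$ with $$\|G\|_{2,\nu,\chi}:=\sup_{q>0}(1+q)^{\chi}|G(q)|+\sum_{\ell=1}^{2}\sup_{q>0}(1+q)^{\chi+\nu+\rho}q^{\ell-\rho-\nu}|G^{(\ell)}(q)|<\infty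 .$$ **Proposition.** $\mathcal B_W$ is a well-defined and continuous bilinear map $X^2_{0,\theta}\times X^2_{0,\theta}\to X^2_{\mu,\theta-\alpha}$. That is, for all $G,H\in X^2_{0,\theta}$ the integrals defining $\mathcal B_W(G,H)$ on $[0,\infty)$ converge absolutely and $\mathcal B_W(G,H)\in X^2_{\mu,\theta-\alpha}$; $\mathcal B_W$ is linear in each argument; and there is a constant $C>0$, which does not depend on $G$ and $H$, such that $$\|\mathcal B_W(G,H)\|_{2,\mu,\theta-\alpha}\le C\,\|G\|_{2,0,\theta}\,\|H\|_{2,0,\theta}\qquad\text{for all }G,H\in X^2_{0,\theta}.$$ -/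

import Mathlib

open Set Filter Topology MeasureTheory
open scoped ENNReal

noncomputable section

namespace FatTail

/-! ### The perturbation kernel `W` and its assumptions -/

/-- The open upper half-plane of `ℂ`. -/
def upperHP : Set ℂ := {z | 0 < z.im}

/-- The open lower half-plane of `ℂ`. -/
def lowerHP : Set ℂ := {z | z.im < 0}

/-- The local weight in the Hölder condition on the derivative of the extension of `W`. -/
def holderWeight (α κ m : ℝ) : ℝ :=
  if m ≤ 1 then m ^ (-α - 1 - κ) else m ^ (α - 1 - κ)

/-- Growth of the derivative and local Hölder continuity of the derivative, with exponent `κ`,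
of an analytic function on a half-plane `S`. -/
def HolderOnHalfPlane (α κ : ℝ) (Wc : ℂ → ℂ) (S : Set ℂ) : Prop :=
  (∃ C : ℝ, ∀ z ∈ S, ‖deriv Wc z‖ ≤ C * (‖z‖ ^ (-α - 1) + ‖z‖ ^ (α - 1))) ∧
  (∃ C : ℝ, ∀ z₁ ∈ S, ∀ z₂ ∈ S, ‖z₁ - z₂‖ ≤ min ‖z₁‖ ‖z₂‖ / 2 →
    ‖deriv Wc z₁ - deriv Wc z₂‖ ≤ C * ‖z₁ - z₂‖ ^ κ * holderWeight α κ (min ‖z₁‖ ‖z₂‖))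

/-- The standing assumptions on the kernel `W : (0,∞) × (0,∞) → ℝ` with exponent `α`;
`Wc` is the analytic extension of `W(·,1)` to the slit plane `ℂ ∖ (-∞,0]`.
Only the values of `W` at positive arguments and of `Wc` on the slit plane are constrained. -/
structure IsPerturbationKernel (α : ℝ) (W : ℝ → ℝ → ℝ) (Wc : ℂ → ℂ) : Prop where
  continuousOn : ContinuousOn (fun p : ℝ × ℝ => W p.1 p.2) (Ioi 0 ×ˢ Ioi 0)
  symm : ∀ x > 0, ∀ y > 0, W x y = W y x
  homogeneous : ∀ a > 0, ∀ x > 0, ∀ y > 0, W (a * x) (a * y) = W x y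
  nonneg : ∀ x > 0, ∀ y > 0, 0 ≤ W x y
  upper_bound : ∀ x > 0, ∀ y > 0, W x y ≤ (x / y) ^ α + (y / x) ^ α
  extends_W : ∀ x : ℝ, 0 < x → Wc (x : ℂ) = (W x 1 : ℂ)
  analytic : AnalyticOnNhd ℂ Wc Complex.slitPlane
  re_nonneg : ∀ z ∈ Complex.slitPlane, 0 ≤ z.re → 0 ≤ (Wc z).re
  inversion : ∀ z ∈ Complex.slitPlane, Wc z = Wc z⁻¹
  growth : ∃ C : ℝ, ∀ z ∈ Complex.slitPlane, ‖Wc z‖ ≤ C * (‖z‖ ^ (-α) + ‖z‖ ^ α)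
  holder : ∃ κ : ℝ, 0 < κ ∧ κ < 1 ∧
    HolderOnHalfPlane α κ Wc upperHP ∧ HolderOnHalfPlane α κ Wc lowerHP

/-! ### The representation kernel of `W(x,y)/(x+y)` as a Laplace integral

The kernel is the (signed) measure `φ(η/ξ)/ξ dξ dη + W(-1) δ(ξ-η)` on `(0,∞) × (0,∞)`, where the
density `φ` is the jump of `W(z)/(1+z)` across the cut `(-∞,0)`, divided by `2πi`. -/

/-- The boundary value `W₊(-s)` of `W` at `-s`, taken from the upper half-plane. -/
def bdryPlus (Wc : ℂ → ℂ) (s : ℝ) : ℂ := extendFrom upperHP Wc (-(s : ℂ))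

/-- The boundary value `W₋(-s)` of `W` at `-s`, taken from the lower half-plane. -/
def bdryMinus (Wc : ℂ → ℂ) (s : ℝ) : ℂ := extendFrom lowerHP Wc (-(s : ℂ))

/-- The function `φ(s) = (W₋(-s) - W₊(-s)) / (2πi (1-s))`, with its continuous value
`(W₋'(-1) - W₊'(-1)) / (2πi)` at `s = 1`. These numbers are real, because `W` is real on `(0,∞)`
and so `W₋(-s)` is the complex conjugate of `W₊(-s)`; the real part only changes the type. -/
def kerPhi (Wc : ℂ → ℂ) (s : ℝ) : ℝ :=
  if s = 1 then
    ((extendFrom lowerHP (deriv Wc) (-1) - extendFrom upperHP (deriv Wc) (-1)) /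
      (2 * (Real.pi : ℂ) * Complex.I)).re
  else
    ((bdryMinus Wc s - bdryPlus Wc s) /
      (2 * (Real.pi : ℂ) * Complex.I * (1 - (s : ℂ)))).re

/-- The absolutely continuous part of the representation kernel. -/
def kerDensity (Wc : ℂ → ℂ) (ξ η : ℝ) : ℝ := kerPhi Wc (η / ξ) / ξ

/-- The number `W(-1) = W₊(-1) = W₋(-1)`, which is real, as the coefficient of the diagonal
part of the representation kernel. -/
def kerDiag (Wc : ℂ → ℂ) : ℝ := (bdryPlus Wc 1).re

/-- Integrability of `F` over `(0,∞) × (0,∞)` against the representation kernel: against its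
absolutely continuous part and against the part on the diagonal. -/
def KerIntegrable (Wc : ℂ → ℂ) (F : ℝ → ℝ → ℝ) : Prop :=
  IntegrableOn (fun p : ℝ × ℝ => kerDensity Wc p.1 p.2 * F p.1 p.2) (Ioi 0 ×ˢ Ioi 0) ∧
  IntegrableOn (fun ξ : ℝ => F ξ ξ) (Ioi 0)

/-- The integral of `F` over `(0,∞) × (0,∞)` against the representation kernel. -/
def kerIntegral (Wc : ℂ → ℂ) (F : ℝ → ℝ → ℝ) : ℝ :=
  (∫ p in (Ioi (0 : ℝ)) ×ˢ (Ioi (0 : ℝ)), kerDensity Wc p.1 p.2 * F p.1 p.2) +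
    kerDiag Wc * ∫ ξ in Ioi (0 : ℝ), F ξ ξ

/-! ### The bilinear form `B_W` in Laplace variables -/

/-- The integrand of `N₁[G,H](r)`, without the kernel. -/
def integrand₁ (G H : ℝ → ℝ) (r ξ η : ℝ) : ℝ :=
  iteratedDeriv 2 G (r + ξ) * (H η - H (η + r))

/-- The integrand of `N₂[G,H](r)`, without the kernel. -/
def integrand₂ (G H : ℝ → ℝ) (r ξ η : ℝ) : ℝ :=
  deriv G (r + ξ) * (deriv H η - deriv H (η + r))

/-- `N₁[G,H](r)`. -/
def formN₁ (Wc : ℂ → ℂ) (G H : ℝ → ℝ) (r : ℝ) : ℝ :=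
  1 / r * kerIntegral Wc (integrand₁ G H r)

/-- `N₂[G,H](r)`. -/
def formN₂ (Wc : ℂ → ℂ) (G H : ℝ → ℝ) (r : ℝ) : ℝ :=
  1 / r * kerIntegral Wc (integrand₂ G H r)

/-- `N[G,H] = N₁[G,H] + N₂[G,H]`. -/
def formN (Wc : ℂ → ℂ) (G H : ℝ → ℝ) (r : ℝ) : ℝ :=
  formN₁ Wc G H r + formN₂ Wc G H r

/-- `B_W(G,H)(q) = ∫_q^∞ ∫_p^∞ N[G,H](r) dr dp`, of interest for `q ≥ 0`. -/
def formBW (Wc : ℂ → ℂ) (G H : ℝ → ℝ) (q : ℝ) : ℝ :=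
  ∫ p in Ioi q, ∫ r in Ioi p, formN Wc G H r

/-- All the integrals that define `B_W(G,H)` on `[0,∞)` converge absolutely. -/
def BWConverges (Wc : ℂ → ℂ) (G H : ℝ → ℝ) : Prop :=
  (∀ r > 0, KerIntegrable Wc (integrand₁ G H r) ∧ KerIntegrable Wc (integrand₂ G H r)) ∧
  (∀ p > 0, IntegrableOn (formN Wc G H) (Ioi p)) ∧
  IntegrableOn (fun p => ∫ r in Ioi p, formN Wc G H r) (Ioi 0)

/-! ### Norms and function spaces

A function on `[0,∞)` is represented by a function `ℝ → ℝ`; its values at negative arguments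
play no role. Norms take values in `[0,∞]`. -/

/-- The seminorm `sup_{q>0} (1+q)^(χ+μ+ρ) q^(k-ρ-μ) |∂^k G(q)|`. -/
def lapSeminorm (ρ : ℝ) (k : ℕ) (μ χ : ℝ) (G : ℝ → ℝ) : ℝ≥0∞ :=
  ⨆ q : ℝ, ⨆ _ : 0 < q,
    ENNReal.ofReal ((1 + q) ^ (χ + μ + ρ) * q ^ ((k : ℝ) - ρ - μ) * |iteratedDeriv k G q|)

/-- The norm with `k ≥ 1` derivatives: the seminorm of order zero with `μ = -ρ`, that is
`sup_{q>0} (1+q)^χ |G(q)|`, plus the seminorms of orders `1, …, k`. -/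
def lapNorm (ρ : ℝ) (k : ℕ) (μ χ : ℝ) (G : ℝ → ℝ) : ℝ≥0∞ :=
  lapSeminorm ρ 0 (-ρ) χ G + ∑ l ∈ Finset.Icc 1 k, lapSeminorm ρ l μ χ G

/-- The space of functions in `C^k((0,∞)) ∩ C([0,∞))` of finite norm, for `k ≥ 1`. -/
def lapSpace (ρ : ℝ) (k : ℕ) (μ χ : ℝ) : Set (ℝ → ℝ) :=
  {G | ContDiffOn ℝ k G (Ioi 0) ∧ ContinuousOn G (Ici 0) ∧ lapNorm ρ k μ χ G < ∞}

end FatTail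

end

/-! On `(0,∞)` the second derivative of `B_W(G,H)` is `N[G,H]` and the first is minus the tail
integral of `N`. Hence it suffices that `N` is continuous and that `|N(r)| ≤ A ‖G‖ ‖H‖ r^(ρ+μ-2)
(1+r)^(-(θ-α+μ+ρ))` (`exists_abs_formN_le`). With `σ = ρ+μ`, the condition `σ < 1` gives the first
tail integral the size `p^(σ-1)`, `σ > 0` makes that integrable at `0`, and `θ > α` makes it
integrable at infinity.

Kernel. The bound on `W'` makes `W` Lipschitz up to the cut away from `0`, so the boundary values
exist. Inversion swaps the half-planes near `-1`, so the two boundary values agree there, and the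
Lipschitz bound compensates the zero of `1-s`. Hence `|φ(s)| ≤ C (s^(-α) + s^α)/(1+s)`
(`exists_kerPhi_bound`). Since `(1+s)⁻¹ ≤ s^(-t)` for every `t ∈ [0,1]`, the density is dominated by
`ξ^(-a) η^(a-1) + ξ^(-b) η^(b-1)` with `a ∈ [-α,1-α]` and `b ∈ [α,1+α]` at free choice
(`exists_kernelBound`). The double integrals thus factor into one-dimensional ones which, like the
diagonal integral, reduce to beta integrals.

Estimates. For `N₁` both weights must lie in `(0,θ)`, for `N₂` in `(1-ρ,1)`, where `H'` may blow up
like `η^(ρ-1)`; the chain `α < θ < ρ` leaves room for both. For `r ≥ 1` the differences of `H` and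
`H'` are bounded term by term, and the weight `1-α` in `N₂` dictates the rate `r^(-(1+θ-α))`, hence
the loss of `α` in the decay. For `r ≤ 1` the differences gain powers of `r` (`abs_sub_le_small`,
`abs_deriv_sub_le_small`), and both kernel integrals are of order `r^(ρ+μ-1)`. -/

namespace FatTail

/-! ### Beta-type integrals over the half-line -/

/-- The function `f` is integrable over `(0,∞)` and its integral is at most `A`. -/
def IntLe (f : ℝ → ℝ) (A : ℝ) : Prop :=
  IntegrableOn f (Ioi 0) ∧ ∫ x in Ioi (0 : ℝ), f x ≤ A

theorem IntLe.congr {f g : ℝ → ℝ} {A : ℝ} (hf : IntLe f A) (h : ∀ x > 0, g x = f x) :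
    IntLe g A := by
  have h' : EqOn f g (Ioi 0) := fun x hx => (h x hx).symm
  refine ⟨hf.1.congr_fun h' measurableSet_Ioi, ?_⟩
  rw [← setIntegral_congr_fun measurableSet_Ioi h']
  exact hf.2

theorem IntLe.le {f : ℝ → ℝ} {A B : ℝ} (hf : IntLe f A) (h : A ≤ B) : IntLe f B :=
  ⟨hf.1, hf.2.trans h⟩

theorem IntLe.mono {f g : ℝ → ℝ} {A M : ℝ} (hg : IntLe g A) (hM : 0 ≤ M)
    (hc : ContinuousOn f (Ioi 0)) (h₀ : ∀ x > 0, 0 ≤ f x) (h : ∀ x > 0, f x ≤ M * g x) :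
    IntLe f (M * A) := by
  have hi : IntegrableOn f (Ioi 0) := by
    refine Integrable.mono' (hg.1.const_mul M) (hc.aestronglyMeasurable measurableSet_Ioi) ?_
    filter_upwards [ae_restrict_mem measurableSet_Ioi] with x hx
    rw [Real.norm_of_nonneg (h₀ x hx)]
    exact h x hx
  refine ⟨hi, ?_⟩
  calc ∫ x in Ioi (0 : ℝ), f x ≤ ∫ x in Ioi (0 : ℝ), M * g x :=
        setIntegral_mono_on hi (hg.1.const_mul M) measurableSet_Ioi h
    _ = M * ∫ x in Ioi (0 : ℝ), g x := integral_const_mul _ _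
    _ ≤ M * A := by gcongr; exact hg.2

theorem one_add_rpow_neg_le {x s t : ℝ} (hx : 0 < x) (ht : 0 ≤ t) (hts : t ≤ s) :
    (1 + x) ^ (-s) ≤ x ^ (-t) :=
  calc (1 + x) ^ (-s) ≤ (1 + x) ^ (-t) :=
        Real.rpow_le_rpow_of_exponent_le (by linarith) (by linarith)
    _ ≤ x ^ (-t) := Real.rpow_le_rpow_of_nonpos hx (by linarith) (by linarith)

theorem integrableOn_beta {p q : ℝ} (hp : 0 < p) (hq : 0 < q) :
    IntegrableOn (fun x : ℝ => x ^ (p - 1) * (1 + x) ^ (-(p + q))) (Ioi 0) := by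
  have hc : ContinuousOn (fun x : ℝ => x ^ (p - 1) * (1 + x) ^ (-(p + q))) (Ioi 0) := by
    intro x hx
    have hx : 0 < x := hx
    exact ((Real.continuousAt_rpow_const _ _ (Or.inl hx.ne')).mul
      ((continuousAt_const.add continuousAt_id).rpow_const
        (Or.inl (by simp; linarith)))).continuousWithinAt
  rw [← Ioc_union_Ioi_eq_Ioi (zero_le_one' ℝ)]
  refine IntegrableOn.union ?_ ?_
  · have h1 : IntegrableOn (fun x : ℝ => x ^ (p - 1)) (Ioc 0 1) := by
      rw [← intervalIntegrable_iff_integrableOn_Ioc_of_le zero_le_one]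
      exact intervalIntegral.intervalIntegrable_rpow' (by linarith)
    refine Integrable.mono' h1
      ((hc.mono Ioc_subset_Ioi_self).aestronglyMeasurable measurableSet_Ioc) ?_
    filter_upwards [ae_restrict_mem measurableSet_Ioc] with x hx
    have hx0 : 0 < x := hx.1
    rw [Real.norm_of_nonneg (by positivity)]
    refine mul_le_of_le_one_right (by positivity) ?_
    exact Real.rpow_le_one_of_one_le_of_nonpos (by linarith) (by linarith)
  · have h1 : IntegrableOn (fun x : ℝ => x ^ (-1 - q)) (Ioi 1) :=
      integrableOn_Ioi_rpow_of_lt (by linarith) one_pos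
    refine Integrable.mono' h1
      ((hc.mono (Ioi_subset_Ioi zero_le_one)).aestronglyMeasurable measurableSet_Ioi) ?_
    filter_upwards [ae_restrict_mem measurableSet_Ioi] with x hx
    have hx1 : 1 < x := hx
    have hx0 : 0 < x := by linarith
    rw [Real.norm_of_nonneg (by positivity)]
    calc x ^ (p - 1) * (1 + x) ^ (-(p + q)) ≤ x ^ (p - 1) * x ^ (-(p + q)) := by
          refine mul_le_mul_of_nonneg_left ?_ (by positivity)
          exact one_add_rpow_neg_le hx0 (by linarith) le_rfl
      _ = x ^ (-1 - q) := by rw [← Real.rpow_add hx0]; congr 1; ring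

/-- The beta integral in its form over `(0,∞)`. -/
noncomputable def betaInt (p q : ℝ) : ℝ :=
  ∫ x in Ioi (0 : ℝ), x ^ (p - 1) * (1 + x) ^ (-(p + q))

theorem betaInt_nonneg (p q : ℝ) : 0 ≤ betaInt p q :=
  setIntegral_nonneg measurableSet_Ioi fun x hx => by
    have : 0 < x := hx
    positivity

/-- The substitution `x ↦ r x` pulls out `r^(-q)`, with equality. This homogeneity is the source of
the powers of `r` in the envelope estimates. -/
theorem intLe_beta {p q r : ℝ} (hp : 0 < p) (hq : 0 < q) (hr : 0 < r) :
    IntLe (fun x : ℝ => x ^ (p - 1) * (r + x) ^ (-(p + q))) (betaInt p q * r ^ (-q)) := by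
  have key : ∀ x > 0, (r * x) ^ (p - 1) * (r + r * x) ^ (-(p + q)) =
      r ^ (-1 - q) * (x ^ (p - 1) * (1 + x) ^ (-(p + q))) := by
    intro x hx
    rw [show r + r * x = r * (1 + x) by ring, Real.mul_rpow hr.le hx.le,
      Real.mul_rpow hr.le (by linarith : 0 ≤ 1 + x),
      show -1 - q = (p - 1) + (-(p + q)) by ring, Real.rpow_add hr]
    ring
  constructor
  · have h := (integrableOn_Ioi_comp_mul_left_iff
      (fun x : ℝ => x ^ (p - 1) * (r + x) ^ (-(p + q))) 0 hr).1
    rw [mul_zero] at h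
    exact h (IntegrableOn.congr_fun ((integrableOn_beta hp hq).const_mul (r ^ (-1 - q)))
      (fun x hx => (key x hx).symm) measurableSet_Ioi)
  · have h := integral_comp_mul_left_Ioi
      (fun x : ℝ => x ^ (p - 1) * (r + x) ^ (-(p + q))) 0 hr
    rw [mul_zero, setIntegral_congr_fun measurableSet_Ioi (fun x hx => key x hx),
      integral_const_mul] at h
    change r ^ (-1 - q) * betaInt p q = _ at h
    rw [smul_eq_mul] at h
    have h2 : r ^ (-1 - q) = r⁻¹ * r ^ (-q) := by
      rw [show -1 - q = (-1) + (-q) by ring, Real.rpow_add hr, Real.rpow_neg_one]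
    rw [h2, mul_assoc] at h
    have h3 := mul_left_cancel₀ (inv_ne_zero hr.ne') h
    rw [← h3, mul_comm]

/-! ### Boundary values of `W` on the cut -/

/-- On the ball, `‖y‖ ≥ ‖x‖/4`, so the derivative is bounded, and the intersection with `S` is
convex, so the mean value inequality applies. The radius exceeds `‖x‖/2` so that the closed interval
`|s - 1| ≤ 1/2` fits into the ball around `-1`. -/
theorem exists_lipschitz_near {α C : ℝ} (hα₀ : 0 < α) (hα₁ : α < 1) {f : ℂ → ℂ} {S : Set ℂ}
    (hS : Convex ℝ S) (hf : ∀ z ∈ S, DifferentiableAt ℂ f z)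
    (hC : ∀ z ∈ S, ‖deriv f z‖ ≤ C * (‖z‖ ^ (-α - 1) + ‖z‖ ^ (α - 1))) {x : ℂ} (hx : x ≠ 0) :
    ∃ M : ℝ, 0 ≤ M ∧ ∀ z ∈ S ∩ Metric.ball x (3 / 4 * ‖x‖), ∀ w ∈ S ∩ Metric.ball x (3 / 4 * ‖x‖),
      ‖f w - f z‖ ≤ M * ‖w - z‖ := by
  have hx' : 0 < ‖x‖ := norm_pos_iff.2 hx
  refine ⟨|C| * ((‖x‖ / 4) ^ (-α - 1) + (‖x‖ / 4) ^ (α - 1)), by positivity,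
    fun z hz w hw => ?_⟩
  refine Convex.norm_image_sub_le_of_norm_deriv_le (s := S ∩ Metric.ball x (3 / 4 * ‖x‖))
    (fun y hy => hf y hy.1) (fun y hy => ?_) (hS.inter (convex_ball x _)) hz hw
  have hy2 : ‖x‖ / 4 ≤ ‖y‖ := by
    have h1 : ‖y - x‖ < 3 / 4 * ‖x‖ := by
      have := hy.2; rwa [Metric.mem_ball, dist_eq_norm] at this
    have h2 : ‖x‖ ≤ ‖y‖ + ‖y - x‖ := by
      have := norm_sub_le y (y - x); rwa [sub_sub_cancel] at this
    linarith
  refine (hC y hy.1).trans ?_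
  have h1 : ‖y‖ ^ (-α - 1) ≤ (‖x‖ / 4) ^ (-α - 1) :=
    Real.rpow_le_rpow_of_nonpos (by positivity) hy2 (by linarith)
  have h2 : ‖y‖ ^ (α - 1) ≤ (‖x‖ / 4) ^ (α - 1) :=
    Real.rpow_le_rpow_of_nonpos (by positivity) hy2 (by linarith)
  calc C * (‖y‖ ^ (-α - 1) + ‖y‖ ^ (α - 1)) ≤ |C| * (‖y‖ ^ (-α - 1) + ‖y‖ ^ (α - 1)) := by
        gcongr; exact le_abs_self C
    _ ≤ _ := by gcongr

theorem nhdsWithin_inter_ball_eq {S : Set ℂ} {x y : ℂ} {r : ℝ} (hy : y ∈ Metric.ball x r) :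
    𝓝[S ∩ Metric.ball x r] y = 𝓝[S] y :=
  nhdsWithin_inter_of_mem' (mem_nhdsWithin_of_mem_nhds (Metric.isOpen_ball.mem_nhds hy))

/-- A Lipschitz map is uniformly continuous, so it sends the Cauchy filter `𝓝[S] x` to a Cauchy
filter, which converges by completeness of `ℂ`. -/
theorem exists_tendsto_of_lipschitz_near {f : ℂ → ℂ} {S : Set ℂ} {x : ℂ} {M r : ℝ} (hr : 0 < r)
    (hM : 0 ≤ M) (hx : x ∈ closure S) (hf : ∀ z ∈ S ∩ Metric.ball x r, ∀ w ∈ S ∩ Metric.ball x r,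
      ‖f w - f z‖ ≤ M * ‖w - z‖) :
    ∃ y, Tendsto f (𝓝[S] x) (𝓝 y) := by
  have := mem_closure_iff_nhdsWithin_neBot.mp hx
  have hL : LipschitzOnWith ⟨M, hM⟩ f (S ∩ Metric.ball x r) :=
    LipschitzOnWith.of_dist_le_mul fun z hz w hw => by
      rw [dist_eq_norm, dist_eq_norm]; exact hf w hw z hz
  have hc : Cauchy (𝓝[S] x) := cauchy_nhds.mono nhdsWithin_le_nhds
  have := hc.map_of_le hL.uniformContinuousOn (by
    rw [← nhdsWithin_inter_ball_eq (Metric.mem_ball_self hr)]; exact inf_le_right)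
  exact cauchy_map_iff_exists_tendsto.1 this

theorem neg_ofReal_mem_closure_upperHP (s : ℝ) : -(s : ℂ) ∈ closure upperHP := by
  have : closure upperHP = {z : ℂ | 0 ≤ z.im} := Complex.closure_setOfPred_lt_im 0
  rw [this]; simp

theorem neg_ofReal_mem_closure_lowerHP (s : ℝ) : -(s : ℂ) ∈ closure lowerHP := by
  have : closure lowerHP = {z : ℂ | z.im ≤ 0} := Complex.closure_setOfPred_im_lt 0
  rw [this]; simp

theorem upperHP_subset_slitPlane : upperHP ⊆ Complex.slitPlane := fun _ hz =>
  Complex.mem_slitPlane_iff.2 (Or.inr (ne_of_gt hz))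

theorem lowerHP_subset_slitPlane : lowerHP ⊆ Complex.slitPlane := fun _ hz =>
  Complex.mem_slitPlane_iff.2 (Or.inr (ne_of_lt hz))

theorem convex_upperHP : Convex ℝ upperHP := convex_halfSpace_im_gt 0

theorem convex_lowerHP : Convex ℝ lowerHP := convex_halfSpace_im_lt 0

/-- Properties of the boundary values on the cut of a function on a half-plane `S`. -/
structure BoundaryData (α : ℝ) (f : ℂ → ℂ) (S : Set ℂ) : Prop where
  tendsto : ∀ s : ℝ, 0 < s → Tendsto f (𝓝[S] (-(s : ℂ))) (𝓝 (extendFrom S f (-(s : ℂ))))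
  continuousOn : ContinuousOn (fun s : ℝ => extendFrom S f (-(s : ℂ))) (Ioi 0)
  bound : ∃ C : ℝ, 0 ≤ C ∧ ∀ s : ℝ, 0 < s →
    ‖extendFrom S f (-(s : ℂ))‖ ≤ C * (s ^ (-α) + s ^ α)
  lipschitz : ∃ M : ℝ, 0 ≤ M ∧ ∀ s : ℝ, |s - 1| ≤ 1 / 2 →
    ‖extendFrom S f (-(s : ℂ)) - extendFrom S f (-((1 : ℝ) : ℂ))‖ ≤ M * |s - 1|

theorem boundaryData {α : ℝ} (hα₀ : 0 < α) (hα₁ : α < 1) {f : ℂ → ℂ} {S : Set ℂ}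
    (hS : Convex ℝ S) (hS' : ∀ s : ℝ, -(s : ℂ) ∈ closure S)
    (hf : ∀ z ∈ S, DifferentiableAt ℂ f z)
    (hd : ∃ C : ℝ, ∀ z ∈ S, ‖deriv f z‖ ≤ C * (‖z‖ ^ (-α - 1) + ‖z‖ ^ (α - 1)))
    (hg : ∃ C : ℝ, ∀ z ∈ S, ‖f z‖ ≤ C * (‖z‖ ^ (-α) + ‖z‖ ^ α)) : BoundaryData α f S := by
  obtain ⟨C, hC⟩ := hd
  have hlim : ∀ s : ℝ, 0 < s → ∃ y, Tendsto f (𝓝[S] (-(s : ℂ))) (𝓝 y) := by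
    intro s hs
    have h0 : (-(s : ℂ)) ≠ 0 := by simpa using hs.ne'
    obtain ⟨M, hM0, hM⟩ := exists_lipschitz_near hα₀ hα₁ hS hf hC h0
    exact exists_tendsto_of_lipschitz_near (by positivity) hM0 (hS' s) hM
  have ht : ∀ s : ℝ, 0 < s →
      Tendsto f (𝓝[S] (-(s : ℂ))) (𝓝 (extendFrom S f (-(s : ℂ)))) :=
    fun s hs => tendsto_extendFrom (hlim s hs)
  have hne : ∀ s : ℝ, (𝓝[S] (-(s : ℂ))).NeBot := fun s =>
    mem_closure_iff_nhdsWithin_neBot.mp (hS' s)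
  refine ⟨ht, ?_, ?_, ?_⟩
  · have h1 : ContinuousOn (extendFrom S f) ((fun s : ℝ => -(s : ℂ)) '' Ioi 0) := by
      refine continuousOn_extendFrom ?_ ?_
      · rintro _ ⟨s, -, rfl⟩; exact hS' s
      · rintro _ ⟨s, hs, rfl⟩; exact hlim s hs
    exact h1.comp (by fun_prop) (mapsTo_image _ _)
  · obtain ⟨C', hC'⟩ := hg
    refine ⟨|C'|, abs_nonneg _, fun s hs => ?_⟩
    have := hne s
    have hn : ‖(-(s : ℂ))‖ = s := by simp [hs.le]
    have h2 : Tendsto (fun z : ℂ => |C'| * (‖z‖ ^ (-α) + ‖z‖ ^ α)) (𝓝[S] (-(s : ℂ)))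
        (𝓝 (|C'| * (s ^ (-α) + s ^ α))) := by
      have : ContinuousAt (fun z : ℂ => |C'| * (‖z‖ ^ (-α) + ‖z‖ ^ α)) (-(s : ℂ)) := by
        have hn' : ‖(-(s : ℂ))‖ ≠ 0 := by rw [hn]; exact hs.ne'
        exact continuousAt_const.mul ((continuousAt_id.norm.rpow_const (Or.inl hn')).add
          (continuousAt_id.norm.rpow_const (Or.inl hn')))
      have h3 := this.tendsto.mono_left (nhdsWithin_le_nhds (s := S))
      rwa [hn] at h3
    refine le_of_tendsto_of_tendsto (ht s hs).norm h2 ?_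
    filter_upwards [self_mem_nhdsWithin] with z hz
    refine (hC' z hz).trans ?_
    gcongr
    exact le_abs_self C'
  · have h0 : (-((1 : ℝ) : ℂ)) ≠ 0 := by simp
    obtain ⟨M, hM0, hM⟩ := exists_lipschitz_near hα₀ hα₁ hS hf hC h0
    have hn1 : ‖(-((1 : ℝ) : ℂ))‖ = 1 := by simp
    rw [hn1, mul_one] at hM
    refine ⟨M, hM0, fun s hs => ?_⟩
    have hs0 : 0 < s := by have := (abs_le.1 hs).1; linarith
    have hb : (-(s : ℂ)) ∈ Metric.ball (-((1 : ℝ) : ℂ)) (3 / 4) := by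
      rw [Metric.mem_ball, dist_eq_norm, show -(s : ℂ) - -((1 : ℝ) : ℂ) = -((s - 1 : ℝ) : ℂ) by
        push_cast; ring, norm_neg, Complex.norm_real, Real.norm_eq_abs]
      linarith
    have hb1 : (-((1 : ℝ) : ℂ)) ∈ Metric.ball (-((1 : ℝ) : ℂ)) (3 / 4) :=
      Metric.mem_ball_self (by norm_num)
    have := hne s
    have := hne 1
    -- Both points approach the boundary independently, along the product filter, and the Lipschitz
    -- bound passes to the limit.
    have t1 : Tendsto (fun p : ℂ × ℂ => ‖f p.1 - f p.2‖)
        (𝓝[S] (-(s : ℂ)) ×ˢ 𝓝[S] (-((1 : ℝ) : ℂ)))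
        (𝓝 ‖extendFrom S f (-(s : ℂ)) - extendFrom S f (-((1 : ℝ) : ℂ))‖) :=
      (((ht s hs0).comp tendsto_fst).sub ((ht 1 one_pos).comp tendsto_snd)).norm
    have t2 : Tendsto (fun p : ℂ × ℂ => M * ‖p.1 - p.2‖)
        (𝓝[S] (-(s : ℂ)) ×ˢ 𝓝[S] (-((1 : ℝ) : ℂ)))
        (𝓝 (M * ‖-(s : ℂ) - -((1 : ℝ) : ℂ)‖)) :=
      (((tendsto_fst.mono_right nhdsWithin_le_nhds).sub
        (tendsto_snd.mono_right nhdsWithin_le_nhds)).norm).const_mul M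
    have hn : ‖-(s : ℂ) - -((1 : ℝ) : ℂ)‖ = |s - 1| := by
      rw [show -(s : ℂ) - -((1 : ℝ) : ℂ) = -((s - 1 : ℝ) : ℂ) by
        push_cast; ring, norm_neg, Complex.norm_real, Real.norm_eq_abs]
    rw [hn] at t2
    refine le_of_tendsto_of_tendsto t1 t2 ?_
    have e1 : S ∩ Metric.ball (-((1 : ℝ) : ℂ)) (3 / 4) ∈ 𝓝[S] (-(s : ℂ)) := by
      rw [← nhdsWithin_inter_ball_eq hb]; exact self_mem_nhdsWithin
    have e2 : S ∩ Metric.ball (-((1 : ℝ) : ℂ)) (3 / 4) ∈ 𝓝[S] (-((1 : ℝ) : ℂ)) := by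
      rw [← nhdsWithin_inter_ball_eq hb1]; exact self_mem_nhdsWithin
    filter_upwards [prod_mem_prod e1 e2] with p hp
    exact hM p.2 hp.2 p.1 hp.1

/-! ### Size and measurability of the density of the representation kernel -/

namespace IsPerturbationKernel

variable {α : ℝ} {W : ℝ → ℝ → ℝ} {Wc : ℂ → ℂ}

theorem boundaryData_upper (hW : IsPerturbationKernel α W Wc) (hα₀ : 0 < α) (hα₁ : α < 1) :
    BoundaryData α Wc upperHP := by
  obtain ⟨C, hC⟩ := hW.growth
  obtain ⟨κ, -, -, h, -⟩ := hW.holder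
  exact boundaryData hα₀ hα₁ convex_upperHP neg_ofReal_mem_closure_upperHP
    (fun z hz => (hW.analytic z (upperHP_subset_slitPlane hz)).differentiableAt) h.1
    ⟨C, fun z hz => hC z (upperHP_subset_slitPlane hz)⟩

theorem boundaryData_lower (hW : IsPerturbationKernel α W Wc) (hα₀ : 0 < α) (hα₁ : α < 1) :
    BoundaryData α Wc lowerHP := by
  obtain ⟨C, hC⟩ := hW.growth
  obtain ⟨κ, -, -, -, h⟩ := hW.holder
  exact boundaryData hα₀ hα₁ convex_lowerHP neg_ofReal_mem_closure_lowerHP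
    (fun z hz => (hW.analytic z (lowerHP_subset_slitPlane hz)).differentiableAt) h.1
    ⟨C, fun z hz => hC z (lowerHP_subset_slitPlane hz)⟩

/-- The map `z ↦ z⁻¹` fixes `-1`, exchanges the half-planes and leaves `Wc` invariant, so both
one-sided limits at `-1` are limits of the same function. -/
theorem bdryPlus_one_eq (hW : IsPerturbationKernel α W Wc) (hα₀ : 0 < α) (hα₁ : α < 1) :
    bdryPlus Wc 1 = bdryMinus Wc 1 := by
  have h1 := (hW.boundaryData_upper hα₀ hα₁).tendsto 1 one_pos
  have h2 := (hW.boundaryData_lower hα₀ hα₁).tendsto 1 one_pos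
  have : (𝓝[upperHP] (-((1 : ℝ) : ℂ))).NeBot :=
    mem_closure_iff_nhdsWithin_neBot.mp (neg_ofReal_mem_closure_upperHP 1)
  have h3 : Tendsto (fun z : ℂ => z⁻¹) (𝓝[upperHP] (-((1 : ℝ) : ℂ)))
      (𝓝[lowerHP] (-((1 : ℝ) : ℂ))) := by
    refine tendsto_nhdsWithin_iff.2 ⟨?_, ?_⟩
    · have : Tendsto (fun z : ℂ => z⁻¹) (𝓝 (-((1 : ℝ) : ℂ))) (𝓝 (-((1 : ℝ) : ℂ))⁻¹) :=
        tendsto_inv₀ (by simp)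
      have e : (-((1 : ℝ) : ℂ))⁻¹ = -((1 : ℝ) : ℂ) := by norm_num
      rw [e] at this
      exact this.mono_left nhdsWithin_le_nhds
    · filter_upwards [self_mem_nhdsWithin] with z hz
      have hz : 0 < z.im := hz
      have hn : 0 < Complex.normSq z := Complex.normSq_pos.2 (by rintro rfl; simp at hz)
      change z⁻¹.im < 0
      rw [Complex.inv_im]
      exact div_neg_of_neg_of_pos (by linarith) hn
  have h4 := h2.comp h3
  refine tendsto_nhds_unique h1 (h4.congr' ?_)
  filter_upwards [self_mem_nhdsWithin] with z hz
  exact (hW.inversion z (upperHP_subset_slitPlane hz)).symm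

/-- Away from `s = 1` the denominator is comparable to `1 + s` and the growth of the boundary values
is enough; near `s = 1` the numerator vanishes to first order. -/
theorem exists_kerPhi_bound (hW : IsPerturbationKernel α W Wc) (hα₀ : 0 < α) (hα₁ : α < 1) :
    ∃ C : ℝ, 0 ≤ C ∧ ∀ s : ℝ, 0 < s →
      |kerPhi Wc s| ≤ C * ((s ^ (-α) + s ^ α) * (1 + s)⁻¹) := by
  obtain ⟨C₁, hC₁0, hC₁⟩ := (hW.boundaryData_upper hα₀ hα₁).bound
  obtain ⟨C₂, hC₂0, hC₂⟩ := (hW.boundaryData_lower hα₀ hα₁).bound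
  obtain ⟨M₁, hM₁0, hM₁⟩ := (hW.boundaryData_upper hα₀ hα₁).lipschitz
  obtain ⟨M₂, hM₂0, hM₂⟩ := (hW.boundaryData_lower hα₀ hα₁).lipschitz
  have hone := hW.bdryPlus_one_eq hα₀ hα₁
  change ∀ s : ℝ, 0 < s → ‖bdryPlus Wc s‖ ≤ _ at hC₁
  change ∀ s : ℝ, 0 < s → ‖bdryMinus Wc s‖ ≤ _ at hC₂
  change ∀ s : ℝ, _ → ‖bdryPlus Wc s - bdryPlus Wc 1‖ ≤ _ at hM₁
  change ∀ s : ℝ, _ → ‖bdryMinus Wc s - bdryMinus Wc 1‖ ≤ _ at hM₂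
  have hpi : 1 ≤ 2 * Real.pi := by linarith [Real.pi_gt_three]
  have hgen : ∀ s : ℝ, s ≠ 1 →
      |kerPhi Wc s| ≤ ‖bdryMinus Wc s - bdryPlus Wc s‖ / |s - 1| := by
    intro s hs
    rw [kerPhi, if_neg hs]
    refine (Complex.abs_re_le_norm _).trans ?_
    rw [norm_div]
    have hn : ‖2 * (Real.pi : ℂ) * Complex.I * (1 - (s : ℂ))‖ = 2 * Real.pi * |s - 1| := by
      rw [norm_mul, show (1 : ℂ) - s = -((s - 1 : ℝ) : ℂ) by push_cast; ring, norm_neg,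
        Complex.norm_real, Real.norm_eq_abs]
      simp [abs_of_pos Real.pi_pos]
    rw [hn]
    have : 0 < |s - 1| := abs_pos.2 (sub_ne_zero.2 hs)
    refine div_le_div_of_nonneg_left (norm_nonneg _) this ?_
    nlinarith
  -- The value at `s = 1` itself is merely absorbed into the constant.
  have hnear : ∀ s : ℝ, 0 < s → |s - 1| ≤ 1 / 2 → |kerPhi Wc s| ≤ M₁ + M₂ + |kerPhi Wc 1| := by
    intro s hs hs1
    by_cases h : s = 1
    · subst h; linarith
    have : 0 < |s - 1| := abs_pos.2 (sub_ne_zero.2 h)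
    have h2 : ‖bdryMinus Wc s - bdryPlus Wc s‖ ≤ (M₁ + M₂) * |s - 1| := by
      have e : bdryMinus Wc s - bdryPlus Wc s =
          (bdryMinus Wc s - bdryMinus Wc 1) - (bdryPlus Wc s - bdryPlus Wc 1) := by
        rw [hone]; ring
      rw [e]
      refine (norm_sub_le _ _).trans ?_
      linarith [hM₁ s hs1, hM₂ s hs1]
    have h3 := hgen s h
    have h4 : ‖bdryMinus Wc s - bdryPlus Wc s‖ / |s - 1| ≤ M₁ + M₂ := by
      rw [div_le_iff₀ this]; exact h2
    linarith [abs_nonneg (kerPhi Wc 1)]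
  set D : ℝ := M₁ + M₂ + |kerPhi Wc 1| with hD
  have hD0 : 0 ≤ D := by positivity
  -- The factor `5/2` is the maximum of `1 + s` on `|s - 1| ≤ 1/2`; outside this interval `1 + s ≤ 5
  -- |s - 1|`.
  refine ⟨5 * (C₁ + C₂) + 5 / 2 * D, by positivity, fun s hs => ?_⟩
  have hp1 : 0 < s ^ (-α) := by positivity
  have hp2 : 0 < s ^ α := by positivity
  have h1s : 0 < 1 + s := by linarith
  rw [← mul_assoc, ← div_eq_mul_inv, le_div_iff₀ h1s]
  by_cases hc : |s - 1| ≤ 1 / 2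
  · have h5 := abs_le.1 hc
    have hsum : 1 ≤ s ^ (-α) + s ^ α := by
      rcases le_total 1 s with h | h
      · linarith [Real.one_le_rpow h hα₀.le]
      · linarith [Real.one_le_rpow_of_pos_of_le_one_of_nonpos hs h (by linarith : -α ≤ 0)]
    have h6 := hnear s hs hc
    calc |kerPhi Wc s| * (1 + s) ≤ D * (5 / 2) := by
          refine mul_le_mul h6 (by linarith) h1s.le hD0
      _ ≤ (5 * (C₁ + C₂) + 5 / 2 * D) * 1 := by nlinarith
      _ ≤ _ := by gcongr
  · push Not at hc
    have hs1 : s ≠ 1 := by rintro rfl; norm_num at hc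
    have h7 : 1 + s ≤ 5 * |s - 1| := by
      rcases lt_abs.1 hc with h | h
      · have := le_abs_self (s - 1); linarith
      · have := neg_le_abs (s - 1); linarith
    have h8 : 0 < |s - 1| := by linarith
    have h9 := hgen s hs1
    have h10 : ‖bdryMinus Wc s - bdryPlus Wc s‖ ≤ (C₁ + C₂) * (s ^ (-α) + s ^ α) := by
      refine (norm_sub_le _ _).trans ?_
      linarith [hC₁ s hs, hC₂ s hs]
    rw [le_div_iff₀ h8] at h9
    calc |kerPhi Wc s| * (1 + s) ≤ |kerPhi Wc s| * (5 * |s - 1|) := by gcongr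
      _ = 5 * (|kerPhi Wc s| * |s - 1|) := by ring
      _ ≤ 5 * ((C₁ + C₂) * (s ^ (-α) + s ^ α)) := by linarith
      _ ≤ _ := by nlinarith [mul_nonneg hD0 (hp1.le.trans (le_add_of_nonneg_right hp2.le))]

theorem continuousOn_kerPhi (hW : IsPerturbationKernel α W Wc) (hα₀ : 0 < α) (hα₁ : α < 1) :
    ContinuousOn (kerPhi Wc) (Ioi 0 \ {1}) := by
  have h1 := (hW.boundaryData_upper hα₀ hα₁).continuousOn
  have h2 := (hW.boundaryData_lower hα₀ hα₁).continuousOn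
  have h3 : ContinuousOn (fun s : ℝ => ((bdryMinus Wc s - bdryPlus Wc s) /
      (2 * (Real.pi : ℂ) * Complex.I * (1 - (s : ℂ)))).re) (Ioi 0 \ {1}) := by
    refine Complex.continuous_re.comp_continuousOn (ContinuousOn.div
      ((h2.sub h1).mono sdiff_subset) (by fun_prop) ?_)
    rintro s ⟨-, hs⟩
    have : (1 : ℂ) - s ≠ 0 := by
      rw [sub_ne_zero]; intro h; exact hs (by exact_mod_cast h.symm)
    simp [Real.pi_ne_zero, this]
  refine h3.congr fun s hs => ?_
  rw [kerPhi, if_neg (show ¬ s = 1 from hs.2)]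

/-- Continuity of `kerPhi` is at hand only off `s = 1`; prescribing the value at that single point,
and zero for `s ≤ 0`, gives a measurable function to compose with the quotient `η/ξ`. -/
theorem aestronglyMeasurable_kerDensity (hW : IsPerturbationKernel α W Wc) (hα₀ : 0 < α)
    (hα₁ : α < 1) : AEStronglyMeasurable (fun p : ℝ × ℝ => kerDensity Wc p.1 p.2)
      (volume.restrict (Ioi 0 ×ˢ Ioi 0)) := by
  have hm1 : Measurable ((Ioi (0 : ℝ) \ {1}).piecewise (kerPhi Wc) 0) :=
    (hW.continuousOn_kerPhi hα₀ hα₁).measurable_piecewise continuousOn_const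
      (measurableSet_Ioi.diff (measurableSet_singleton 1))
  have hm2 : Measurable fun s : ℝ =>
      if s = 1 then kerPhi Wc 1 else (Ioi (0 : ℝ) \ {1}).piecewise (kerPhi Wc) 0 s :=
    Measurable.ite (measurableSet_singleton 1) measurable_const hm1
  have hm3 : Measurable fun p : ℝ × ℝ => (if p.2 / p.1 = 1 then kerPhi Wc 1 else
      (Ioi (0 : ℝ) \ {1}).piecewise (kerPhi Wc) 0 (p.2 / p.1)) / p.1 :=
    (hm2.comp (measurable_snd.div measurable_fst)).div measurable_fst
  refine hm3.aestronglyMeasurable.congr ?_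
  filter_upwards [ae_restrict_mem (measurableSet_Ioi.prod measurableSet_Ioi)] with p hp
  have h1 : 0 < p.1 := hp.1
  have h2 : 0 < p.2 := hp.2
  rw [kerDensity]
  by_cases h : p.2 / p.1 = 1
  · rw [if_pos h, h]
  · rw [if_neg h, piecewise_eq_of_mem]
    exact ⟨div_pos h2 h1, h⟩

end IsPerturbationKernel

/-! ### Domination of the kernel by products of powers -/

theorem inv_one_add_le {s t : ℝ} (hs : 0 < s) (ht₀ : 0 ≤ t) (ht₁ : t ≤ 1) :
    (1 + s)⁻¹ ≤ s ^ (-t) := by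
  have := one_add_rpow_neg_le hs ht₀ ht₁
  rwa [Real.rpow_neg_one] at this

/-- What is used of the representation kernel: a bound of its density by products of powers. -/
structure KernelBound (α C : ℝ) (Wc : ℂ → ℂ) : Prop where
  nonneg : 0 ≤ C
  meas : AEStronglyMeasurable (fun p : ℝ × ℝ => kerDensity Wc p.1 p.2)
    (volume.restrict (Ioi 0 ×ˢ Ioi 0))
  diag : |kerDiag Wc| ≤ C
  density : ∀ a b : ℝ, -α ≤ a → a ≤ 1 - α → α ≤ b → b ≤ 1 + α → ∀ ξ > 0, ∀ η > 0,
    |kerDensity Wc ξ η| ≤ C * (ξ ^ (-a) * η ^ (a - 1) + ξ ^ (-b) * η ^ (b - 1))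

/-- With `s = η/ξ`, apply `(1+s)⁻¹ ≤ s^(-t)` with `t = 1-α-a` to the term `s^(-α)` and with `t =
1+α-b` to the term `s^α`. The ranges of `a` and `b` say exactly that `t ∈ [0,1]`. -/
theorem IsPerturbationKernel.exists_kernelBound {α : ℝ} {W : ℝ → ℝ → ℝ} {Wc : ℂ → ℂ}
    (hW : IsPerturbationKernel α W Wc) (hα₀ : 0 < α) (hα₁ : α < 1) :
    ∃ C, KernelBound α C Wc := by
  obtain ⟨C, hC0, hC⟩ := hW.exists_kerPhi_bound hα₀ hα₁
  refine ⟨C + |kerDiag Wc|, by positivity, hW.aestronglyMeasurable_kerDensity hα₀ hα₁,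
    by linarith, fun a b ha₁ ha₂ hb₁ hb₂ ξ hξ η hη => ?_⟩
  have hs : 0 < η / ξ := by positivity
  have key : ∀ c : ℝ, (η / ξ) ^ (c - 1) * ξ⁻¹ = ξ ^ (-c) * η ^ (c - 1) := by
    intro c
    rw [Real.div_rpow hη.le hξ.le, div_eq_mul_inv, ← Real.rpow_neg hξ.le, mul_assoc,
      ← Real.rpow_neg_one ξ, ← Real.rpow_add hξ, mul_comm]
    congr 2; ring
  have e1 : (η / ξ) ^ (-α) * (1 + η / ξ)⁻¹ ≤ (η / ξ) ^ (a - 1) :=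
    calc (η / ξ) ^ (-α) * (1 + η / ξ)⁻¹ ≤ (η / ξ) ^ (-α) * (η / ξ) ^ (-(1 - α - a)) := by
          gcongr
          exact inv_one_add_le hs (by linarith) (by linarith)
      _ = _ := by rw [← Real.rpow_add hs]; congr 1; ring
  have e2 : (η / ξ) ^ α * (1 + η / ξ)⁻¹ ≤ (η / ξ) ^ (b - 1) :=
    calc (η / ξ) ^ α * (1 + η / ξ)⁻¹ ≤ (η / ξ) ^ α * (η / ξ) ^ (-(1 + α - b)) := by
          gcongr
          exact inv_one_add_le hs (by linarith) (by linarith)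
      _ = _ := by rw [← Real.rpow_add hs]; congr 1; ring
  rw [kerDensity, abs_div, abs_of_pos hξ, div_eq_mul_inv, ← key a, ← key b, ← add_mul, ← mul_assoc]
  gcongr
  refine (hC _ hs).trans ?_
  rw [add_mul]
  exact mul_le_mul (le_add_of_nonneg_right (abs_nonneg _)) (add_le_add e1 e2) (by positivity)
    (by positivity)

/-! ### Kernel integrals of products -/

/-- Weighted integrability of a pair of envelopes, which makes their product integrable against
the representation kernel. -/
structure Envelope (a b : ℝ) (U V : ℝ → ℝ) : Prop where
  left_a : IntegrableOn (fun x => x ^ (-a) * U x) (Ioi 0)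
  right_a : IntegrableOn (fun x => x ^ (a - 1) * V x) (Ioi 0)
  left_b : IntegrableOn (fun x => x ^ (-b) * U x) (Ioi 0)
  right_b : IntegrableOn (fun x => x ^ (b - 1) * V x) (Ioi 0)
  diag : IntegrableOn (fun x => U x * V x) (Ioi 0)

/-- The bound for the kernel integral of a product with envelopes `U` and `V`. -/
noncomputable def envInt (a b : ℝ) (U V : ℝ → ℝ) : ℝ :=
  (∫ x in Ioi (0 : ℝ), x ^ (-a) * U x) * (∫ x in Ioi (0 : ℝ), x ^ (a - 1) * V x) +
  (∫ x in Ioi (0 : ℝ), x ^ (-b) * U x) * (∫ x in Ioi (0 : ℝ), x ^ (b - 1) * V x) +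
  ∫ x in Ioi (0 : ℝ), U x * V x

/-- The dominating function for the absolutely continuous part of a kernel integral. -/
noncomputable def envDom (a b : ℝ) (U V : ℝ → ℝ) (p : ℝ × ℝ) : ℝ :=
  (p.1 ^ (-a) * U p.1) * (p.2 ^ (a - 1) * V p.2) + (p.1 ^ (-b) * U p.1) * (p.2 ^ (b - 1) * V p.2)

theorem volume_restrict_quadrant : (volume : Measure (ℝ × ℝ)).restrict (Ioi 0 ×ˢ Ioi 0) =
    ((volume : Measure ℝ).restrict (Ioi 0)).prod ((volume : Measure ℝ).restrict (Ioi 0)) := by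
  rw [Measure.prod_restrict, Measure.volume_eq_prod]

namespace Envelope

variable {a b : ℝ} {U V : ℝ → ℝ}

theorem integrableOn_envDom (E : Envelope a b U V) :
    IntegrableOn (envDom a b U V) (Ioi 0 ×ˢ Ioi 0) := by
  rw [IntegrableOn, volume_restrict_quadrant]
  exact (E.left_a.mul_prod E.right_a).add (E.left_b.mul_prod E.right_b)

theorem integral_envDom (E : Envelope a b U V) :
    ∫ p in Ioi (0 : ℝ) ×ˢ Ioi (0 : ℝ), envDom a b U V p =
      (∫ x in Ioi (0 : ℝ), x ^ (-a) * U x) * (∫ x in Ioi (0 : ℝ), x ^ (a - 1) * V x) +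
      (∫ x in Ioi (0 : ℝ), x ^ (-b) * U x) * (∫ x in Ioi (0 : ℝ), x ^ (b - 1) * V x) := by
  rw [volume_restrict_quadrant]
  refine (integral_add (E.left_a.mul_prod E.right_a) (E.left_b.mul_prod E.right_b)).trans ?_
  exact congrArg₂ (· + ·)
    (integral_prod_mul (fun x : ℝ => x ^ (-a) * U x) (fun x : ℝ => x ^ (a - 1) * V x))
    (integral_prod_mul (fun x : ℝ => x ^ (-b) * U x) (fun x : ℝ => x ^ (b - 1) * V x))

end Envelope

namespace KernelBound

variable {α C a b g h : ℝ} {Wc : ℂ → ℂ} {U V u v : ℝ → ℝ}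

theorem aestronglyMeasurable_mul (hK : KernelBound α C Wc) (hu : ContinuousOn u (Ioi 0))
    (hv : ContinuousOn v (Ioi 0)) :
    AEStronglyMeasurable (fun p : ℝ × ℝ => kerDensity Wc p.1 p.2 * (u p.1 * v p.2))
      (volume.restrict (Ioi 0 ×ˢ Ioi 0)) := by
  refine hK.meas.mul (ContinuousOn.aestronglyMeasurable ?_
    (measurableSet_Ioi.prod measurableSet_Ioi))
  exact (hu.comp continuousOn_fst fun p hp => hp.1).mul
    (hv.comp continuousOn_snd fun p hp => hp.2)

/-- Against `u(ξ) v(η)` the kernel bound leaves two functions of product form, so domination only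
requires one-dimensional integrability. -/
theorem norm_mul_le (hK : KernelBound α C Wc) (ha₁ : -α ≤ a) (ha₂ : a ≤ 1 - α) (hb₁ : α ≤ b)
    (hb₂ : b ≤ 1 + α) (hU : ∀ x > 0, |u x| ≤ g * U x) (hV : ∀ x > 0, |v x| ≤ h * V x)
    {p : ℝ × ℝ} (hp : p ∈ Ioi (0 : ℝ) ×ˢ Ioi (0 : ℝ)) :
    ‖kerDensity Wc p.1 p.2 * (u p.1 * v p.2)‖ ≤ C * g * h * envDom a b U V p := by
  have h1 : 0 < p.1 := hp.1
  have h2 : 0 < p.2 := hp.2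
  rw [Real.norm_eq_abs, abs_mul, abs_mul]
  calc |kerDensity Wc p.1 p.2| * (|u p.1| * |v p.2|)
      ≤ (C * (p.1 ^ (-a) * p.2 ^ (a - 1) + p.1 ^ (-b) * p.2 ^ (b - 1))) *
        ((g * U p.1) * (h * V p.2)) := by
        have := hK.nonneg
        refine mul_le_mul (hK.density a b ha₁ ha₂ hb₁ hb₂ _ h1 _ h2) ?_ (by positivity)
          (by positivity)
        exact mul_le_mul (hU _ h1) (hV _ h2) (abs_nonneg _) ((abs_nonneg _).trans (hU _ h1))
    _ = _ := by rw [envDom]; ring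

theorem abs_diag_le (hU : ∀ x > 0, |u x| ≤ g * U x) (hV : ∀ x > 0, |v x| ≤ h * V x) {x : ℝ}
    (hx : 0 < x) : ‖u x * v x‖ ≤ g * h * (U x * V x) := by
  rw [Real.norm_eq_abs, abs_mul]
  calc |u x| * |v x| ≤ (g * U x) * (h * V x) :=
        mul_le_mul (hU _ hx) (hV _ hx) (abs_nonneg _) ((abs_nonneg _).trans (hU _ hx))
    _ = _ := by ring

theorem kerIntegrable_mul (hK : KernelBound α C Wc) (ha₁ : -α ≤ a) (ha₂ : a ≤ 1 - α)
    (hb₁ : α ≤ b) (hb₂ : b ≤ 1 + α) (E : Envelope a b U V) (hu : ContinuousOn u (Ioi 0))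
    (hv : ContinuousOn v (Ioi 0)) (hU : ∀ x > 0, |u x| ≤ g * U x)
    (hV : ∀ x > 0, |v x| ≤ h * V x) : KerIntegrable Wc (fun ξ η => u ξ * v η) := by
  constructor
  · refine Integrable.mono' (E.integrableOn_envDom.const_mul (C * g * h))
      (hK.aestronglyMeasurable_mul hu hv) ?_
    filter_upwards [ae_restrict_mem (measurableSet_Ioi.prod measurableSet_Ioi)] with p hp
    exact hK.norm_mul_le ha₁ ha₂ hb₁ hb₂ hU hV hp
  · refine Integrable.mono' (E.diag.const_mul (g * h))
      ((hu.mul hv).aestronglyMeasurable measurableSet_Ioi) ?_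
    filter_upwards [ae_restrict_mem measurableSet_Ioi] with x hx
    exact abs_diag_le hU hV hx

theorem abs_kerIntegral_mul_le (hK : KernelBound α C Wc) (ha₁ : -α ≤ a) (ha₂ : a ≤ 1 - α)
    (hb₁ : α ≤ b) (hb₂ : b ≤ 1 + α) (E : Envelope a b U V) (hU : ∀ x > 0, |u x| ≤ g * U x)
    (hV : ∀ x > 0, |v x| ≤ h * V x) :
    |kerIntegral Wc (fun ξ η => u ξ * v η)| ≤ C * g * h * envInt a b U V := by
  have h1 : ‖∫ p in Ioi (0 : ℝ) ×ˢ Ioi (0 : ℝ), kerDensity Wc p.1 p.2 * (u p.1 * v p.2)‖ ≤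
      ∫ p in Ioi (0 : ℝ) ×ˢ Ioi (0 : ℝ), C * g * h * envDom a b U V p := by
    refine norm_integral_le_of_norm_le (E.integrableOn_envDom.const_mul (C * g * h)) ?_
    filter_upwards [ae_restrict_mem (measurableSet_Ioi.prod measurableSet_Ioi)] with p hp
    exact hK.norm_mul_le ha₁ ha₂ hb₁ hb₂ hU hV hp
  have h2 : ‖∫ x in Ioi (0 : ℝ), u x * v x‖ ≤ ∫ x in Ioi (0 : ℝ), g * h * (U x * V x) := by
    refine norm_integral_le_of_norm_le (E.diag.const_mul (g * h)) ?_
    filter_upwards [ae_restrict_mem measurableSet_Ioi] with x hx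
    exact abs_diag_le hU hV hx
  rw [integral_const_mul, E.integral_envDom, Real.norm_eq_abs] at h1
  rw [integral_const_mul, Real.norm_eq_abs] at h2
  rw [kerIntegral]
  refine (abs_add_le _ _).trans ?_
  rw [abs_mul]
  have h3 := mul_le_mul hK.diag h2 (abs_nonneg _) hK.nonneg
  rw [envInt]
  linarith

/-- Dominated convergence, with one pair of envelopes valid for all `r` near `r₀`. -/
theorem continuousAt_kerIntegral_mul (hK : KernelBound α C Wc) (ha₁ : -α ≤ a)
    (ha₂ : a ≤ 1 - α) (hb₁ : α ≤ b) (hb₂ : b ≤ 1 + α) (E : Envelope a b U V)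
    {u v : ℝ → ℝ → ℝ} {r₀ : ℝ}
    (hu : ∀ᶠ r in 𝓝 r₀, ContinuousOn (u r) (Ioi 0) ∧ ∀ x > 0, |u r x| ≤ g * U x)
    (hv : ∀ᶠ r in 𝓝 r₀, ContinuousOn (v r) (Ioi 0) ∧ ∀ x > 0, |v r x| ≤ h * V x)
    (hu' : ∀ x > 0, ContinuousAt (fun r => u r x) r₀)
    (hv' : ∀ x > 0, ContinuousAt (fun r => v r x) r₀) :
    ContinuousAt (fun r => kerIntegral Wc (fun ξ η => u r ξ * v r η)) r₀ := by
  refine ContinuousAt.add ?_ (continuousAt_const.mul ?_)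
  · refine continuousAt_of_dominated (bound := fun p => C * g * h * envDom a b U V p) ?_ ?_
      (E.integrableOn_envDom.const_mul _) ?_
    · filter_upwards [hu, hv] with r h1 h2
      exact hK.aestronglyMeasurable_mul h1.1 h2.1
    · filter_upwards [hu, hv] with r h1 h2
      filter_upwards [ae_restrict_mem (measurableSet_Ioi.prod measurableSet_Ioi)] with p hp
      exact hK.norm_mul_le ha₁ ha₂ hb₁ hb₂ h1.2 h2.2 hp
    · filter_upwards [ae_restrict_mem (measurableSet_Ioi.prod measurableSet_Ioi)] with p hp
      exact continuousAt_const.mul ((hu' _ hp.1).mul (hv' _ hp.2))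
  · refine continuousAt_of_dominated (bound := fun x => g * h * (U x * V x)) ?_ ?_
      (E.diag.const_mul _) ?_
    · filter_upwards [hu, hv] with r h1 h2
      exact (h1.1.mul h2.1).aestronglyMeasurable measurableSet_Ioi
    · filter_upwards [hu, hv] with r h1 h2
      filter_upwards [ae_restrict_mem measurableSet_Ioi] with x hx
      exact abs_diag_le h1.2 h2.2 hx
    · filter_upwards [ae_restrict_mem measurableSet_Ioi] with x hx
      exact (hu' _ hx).mul (hv' _ hx)

end KernelBound

theorem kerIntegral_linear {Wc : ℂ → ℂ} {F₁ F₂ F : ℝ → ℝ → ℝ} (a b : ℝ)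
    (h₁ : KerIntegrable Wc F₁) (h₂ : KerIntegrable Wc F₂)
    (hF : ∀ ξ > 0, ∀ η > 0, F ξ η = a * F₁ ξ η + b * F₂ ξ η) :
    kerIntegral Wc F = a * kerIntegral Wc F₁ + b * kerIntegral Wc F₂ := by
  have e1 : ∫ p in Ioi (0 : ℝ) ×ˢ Ioi (0 : ℝ), kerDensity Wc p.1 p.2 * F p.1 p.2 =
      a * (∫ p in Ioi (0 : ℝ) ×ˢ Ioi (0 : ℝ), kerDensity Wc p.1 p.2 * F₁ p.1 p.2) +
      b * ∫ p in Ioi (0 : ℝ) ×ˢ Ioi (0 : ℝ), kerDensity Wc p.1 p.2 * F₂ p.1 p.2 := by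
    rw [← integral_const_mul, ← integral_const_mul,
      ← integral_add (h₁.1.const_mul a) (h₂.1.const_mul b)]
    refine setIntegral_congr_fun (measurableSet_Ioi.prod measurableSet_Ioi) fun p hp => ?_
    rw [hF _ hp.1 _ hp.2]; ring
  have e2 : ∫ x in Ioi (0 : ℝ), F x x =
      a * (∫ x in Ioi (0 : ℝ), F₁ x x) + b * ∫ x in Ioi (0 : ℝ), F₂ x x := by
    rw [← integral_const_mul, ← integral_const_mul,
      ← integral_add (h₁.2.const_mul a) (h₂.2.const_mul b)]
    exact setIntegral_congr_fun measurableSet_Ioi fun x hx => hF _ hx _ hx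
  rw [kerIntegral, kerIntegral, kerIntegral, e1, e2]
  ring

/-! ### The envelopes and their weighted integrals -/

theorem rpow_le_rpow_of_le_one {r s t : ℝ} (hr₀ : 0 < r) (hr : r ≤ 1) (h : t ≤ s) :
    r ^ s ≤ r ^ t :=
  Real.rpow_le_rpow_of_exponent_ge hr₀ hr h

theorem continuousOn_add_rpow {r s : ℝ} (hr : 0 < r) :
    ContinuousOn (fun x : ℝ => (r + x) ^ s) (Ioi 0) :=
  (by fun_prop : ContinuousOn (fun x : ℝ => r + x) (Ioi 0)).rpow_const fun x hx =>
    Or.inl (by have : 0 < x := hx; positivity)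

theorem continuousOn_rpow_Ioi {s : ℝ} : ContinuousOn (fun x : ℝ => x ^ s) (Ioi 0) :=
  continuousOn_id.rpow_const fun _ hx => Or.inl (ne_of_gt hx)

/-- Weighted integrability of `U` and `V` with exponent `c`, and a bound for the product of the
integrals. -/
structure PairLe (c : ℝ) (U V : ℝ → ℝ) (B : ℝ) : Prop where
  left : IntegrableOn (fun x => x ^ (-c) * U x) (Ioi 0)
  right : IntegrableOn (fun x => x ^ (c - 1) * V x) (Ioi 0)
  le : (∫ x in Ioi (0 : ℝ), x ^ (-c) * U x) * (∫ x in Ioi (0 : ℝ), x ^ (c - 1) * V x) ≤ B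

theorem PairLe.of_intLe {c A A' B : ℝ} {U V : ℝ → ℝ} (hA : 0 ≤ A)
    (hl : IntLe (fun x => x ^ (-c) * U x) A) (hr : IntLe (fun x => x ^ (c - 1) * V x) A')
    (hV : ∀ x > 0, 0 ≤ V x) (h : A * A' ≤ B) : PairLe c U V B := by
  refine ⟨hl.1, hr.1, le_trans (mul_le_mul hl.2 hr.2 ?_ hA) h⟩
  refine setIntegral_nonneg measurableSet_Ioi fun x hx => ?_
  have h0 : 0 < x := hx
  exact mul_nonneg (by positivity) (hV x hx)

theorem PairLe.mono {c B B' : ℝ} {U V : ℝ → ℝ} (h : PairLe c U V B) (hB : B ≤ B') :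
    PairLe c U V B' := ⟨h.left, h.right, h.le.trans hB⟩

theorem Envelope.of_pairLe {a b A B D : ℝ} {U V : ℝ → ℝ} (ha : PairLe a U V A)
    (hb : PairLe b U V B) (hd : IntLe (fun x => U x * V x) D) :
    Envelope a b U V ∧ envInt a b U V ≤ A + B + D :=
  ⟨⟨ha.left, ha.right, hb.left, hb.right, hd.1⟩, add_le_add (add_le_add ha.le hb.le) hd.2⟩

/-! #### The envelopes for second derivatives of the first argument -/

section

variable {ρ θ μ c : ℝ}

/-- The left integral needs `c < 1` and carries all of the power of `r`; the right one does not
depend on `r` and needs `0 < c < θ`. -/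
theorem pairLe_crude_one (hc₀ : 0 < c) (hc₁ : c < 1) (hcθ : c < θ) :
    ∃ A : ℝ, 0 ≤ A ∧ ∀ r > 0, PairLe c (fun x => (r + x) ^ (-(θ + 2)))
      (fun x => (1 + x) ^ (-θ)) (A * r ^ (-(θ + 1 + c))) := by
  refine ⟨betaInt (1 - c) (θ + 1 + c) * betaInt c (θ - c),
    mul_nonneg (betaInt_nonneg _ _) (betaInt_nonneg _ _), fun r hr => ?_⟩
  have h1 := intLe_beta (p := 1 - c) (q := θ + 1 + c) (by linarith) (by linarith) hr
  have h2 := intLe_beta (p := c) (q := θ - c) hc₀ (by linarith) one_pos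
  refine PairLe.of_intLe (mul_nonneg (betaInt_nonneg _ _) (by positivity))
    (h1.congr fun x _ => ?_) (h2.congr fun x _ => ?_) (fun x hx => by positivity) (le_of_eq ?_)
  · congr 2 <;> ring
  · congr 2; ring
  · rw [Real.one_rpow]; ring

theorem intLe_diag_crude_one (hθ : 0 < θ) {r : ℝ} (hr : 0 < r) :
    IntLe (fun x => (r + x) ^ (-(θ + 2)) * (1 + x) ^ (-θ))
      (betaInt 1 (θ + 1) * r ^ (-(θ + 1))) := by
  have h1 := intLe_beta (p := 1) (q := θ + 1) one_pos (by linarith) hr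
  have h2 := h1.mono (f := fun x => (r + x) ^ (-(θ + 2)) * (1 + x) ^ (-θ)) zero_le_one
    ((continuousOn_add_rpow hr).mul (continuousOn_add_rpow one_pos))
    (fun x hx => by positivity) fun x hx => ?_
  · rwa [one_mul] at h2
  · rw [one_mul, sub_self, Real.rpow_zero, one_mul, show 1 + (θ + 1) = θ + 2 by ring]
    refine mul_le_of_le_one_right (by positivity) ?_
    exact Real.rpow_le_one_of_one_le_of_nonpos (by linarith) (by linarith)

/-- Both integrals scale in `r`, with exponents `-(1-ρ+c)` and `(μ+θ)-(θ-c)`. The weight `c` cancels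
in the sum, so every admissible weight yields the same power. -/
theorem pairLe_small_one (hρ : ρ < 1) (hc₀ : 0 < c) (hc₁ : c < 1) (hcθ : c < θ) :
    ∃ A : ℝ, 0 ≤ A ∧ ∀ r > 0, PairLe c (fun x => (r + x) ^ (ρ - 2))
      (fun x => r ^ (μ + θ) * (r + x) ^ (-θ)) (A * r ^ (ρ + μ - 1)) := by
  refine ⟨betaInt (1 - c) (1 - ρ + c) * betaInt c (θ - c),
    mul_nonneg (betaInt_nonneg _ _) (betaInt_nonneg _ _), fun r hr => ?_⟩
  have h1 := intLe_beta (p := 1 - c) (q := 1 - ρ + c) (by linarith) (by linarith) hr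
  have h2 := (intLe_beta (p := c) (q := θ - c) hc₀ (by linarith) hr).mono
    (f := fun x => x ^ (c - 1) * (r ^ (μ + θ) * (r + x) ^ (-θ))) (M := r ^ (μ + θ))
    (by positivity) (continuousOn_rpow_Ioi.mul (continuousOn_const.mul (continuousOn_add_rpow hr)))
    (fun x hx => by positivity) (fun x hx => le_of_eq (by
      rw [show c + (θ - c) = θ by ring]; ring))
  refine PairLe.of_intLe (mul_nonneg (betaInt_nonneg _ _) (by positivity))
    (h1.congr fun x _ => ?_) h2 (fun x hx => by positivity) (le_of_eq ?_)
  · congr 2 <;> ring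
  · rw [show ρ + μ - 1 = -(1 - ρ + c) + ((μ + θ) + -(θ - c)) by ring,
      Real.rpow_add hr (-(1 - ρ + c)) (μ + θ + -(θ - c)), Real.rpow_add hr (μ + θ) (-(θ - c))]
    ring

theorem intLe_diag_small_one (hρ : ρ < 1) (hθ : 0 < θ) {r : ℝ} (hr : 0 < r) :
    IntLe (fun x => (r + x) ^ (ρ - 2) * (r ^ (μ + θ) * (r + x) ^ (-θ)))
      (betaInt 1 (1 - ρ) * r ^ (ρ + μ - 1)) := by
  have h1 := intLe_beta (p := 1) (q := 1 - ρ) one_pos (by linarith) hr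
  have h2 := h1.mono (f := fun x => (r + x) ^ (ρ - 2) * (r ^ (μ + θ) * (r + x) ^ (-θ)))
    (M := r ^ μ) (by positivity)
    ((continuousOn_add_rpow hr).mul (continuousOn_const.mul (continuousOn_add_rpow hr)))
    (fun x hx => by positivity) fun x hx => ?_
  · refine h2.le (le_of_eq ?_)
    rw [show ρ + μ - 1 = μ + -(1 - ρ) by ring, Real.rpow_add hr]; ring
  · rw [sub_self, Real.rpow_zero, one_mul, show -(1 + (1 - ρ)) = ρ - 2 by ring, mul_comm]
    have : r ^ (μ + θ) * (r + x) ^ (-θ) ≤ r ^ μ :=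
      calc r ^ (μ + θ) * (r + x) ^ (-θ) ≤ r ^ (μ + θ) * r ^ (-θ) := by
            refine mul_le_mul_of_nonneg_left ?_ (by positivity)
            exact Real.rpow_le_rpow_of_nonpos hr (by linarith) (by linarith)
        _ = r ^ μ := by rw [← Real.rpow_add hr]; congr 1; ring
    gcongr

/-! #### The envelopes for first derivatives -/

/-- The condition `c > 1-ρ` makes `x^(c-1) x^(ρ-1)` integrable at `0`. -/
theorem pairLe_crude_two (hθ : 0 < θ) (hc₀ : 1 - ρ < c) (hc : 0 < c) (hc₁ : c < 1) :
    ∃ A : ℝ, 0 ≤ A ∧ ∀ r > 0, PairLe c (fun x => (r + x) ^ (-(θ + 1)))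
      (fun x => x ^ (ρ - 1) * (1 + x) ^ (-(θ + ρ))) (A * r ^ (-(θ + c))) := by
  refine ⟨betaInt (1 - c) (θ + c) * betaInt (c + ρ - 1) (θ + 1 - c),
    mul_nonneg (betaInt_nonneg _ _) (betaInt_nonneg _ _), fun r hr => ?_⟩
  have h1 := intLe_beta (p := 1 - c) (q := θ + c) (by linarith) (by linarith) hr
  have h2 := intLe_beta (p := c + ρ - 1) (q := θ + 1 - c) (by linarith) (by linarith) one_pos
  refine PairLe.of_intLe (mul_nonneg (betaInt_nonneg _ _) (by positivity))
    (h1.congr fun x _ => ?_) (h2.congr fun x hx => ?_) (fun x hx => by positivity) (le_of_eq ?_)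
  · congr 2 <;> ring
  · rw [← mul_assoc, ← Real.rpow_add hx]
    congr 2 <;> ring
  · rw [Real.one_rpow]; ring

theorem intLe_diag_crude_two (hρ : 0 < ρ) (hθ : 0 < θ) {r : ℝ} (hr : 0 < r) :
    IntLe (fun x => (r + x) ^ (-(θ + 1)) * (x ^ (ρ - 1) * (1 + x) ^ (-(θ + ρ))))
      (betaInt ρ θ * r ^ (-(θ + 1))) := by
  have h1 := intLe_beta (p := ρ) (q := θ) hρ hθ one_pos
  have h2 := h1.mono
    (f := fun x => (r + x) ^ (-(θ + 1)) * (x ^ (ρ - 1) * (1 + x) ^ (-(θ + ρ))))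
    (M := r ^ (-(θ + 1))) (by positivity)
    ((continuousOn_add_rpow hr).mul (continuousOn_rpow_Ioi.mul (continuousOn_add_rpow one_pos)))
    (fun x hx => by positivity) fun x hx => ?_
  · refine h2.le (le_of_eq ?_)
    rw [Real.one_rpow]; ring
  · rw [add_comm ρ θ]
    refine mul_le_mul_of_nonneg_right ?_ (by positivity)
    exact Real.rpow_le_rpow_of_nonpos hr (by linarith) (by linarith)

/-- The left integral may or may not stay bounded as `r → 0`, depending on the sign of `c - ρ`.
Splitting `(r+x)^(ρ-1) ≤ r^(-e) x^(ρ-1+e)` treats all cases at once, at the price `r^(-e)`. -/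
theorem pairLe_small_two (hρ₁ : ρ < 1) (hθ : 0 < θ) (hμ : μ < ρ) (hμ' : μ < 1 - ρ)
    (hc₀ : 1 - ρ < c) (hc₁ : c < 1) :
    ∃ A : ℝ, 0 ≤ A ∧ ∀ r > 0, r ≤ 1 →
      PairLe c (fun x => (r + x) ^ (ρ - 1) * (1 + x) ^ (-(θ + ρ)))
        (fun x => r * (x ^ (ρ - 1) * (r + x) ^ (-1 : ℝ))) (A * r ^ (ρ + μ - 1)) := by
  -- Integrability at `0` requires `e > c-ρ`, the splitting requires `0 ≤ e ≤ 1-ρ`, and the total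
  -- exponent `ρ-1+c-e` is at least `ρ+μ-1` when `e ≤ c-μ`. The minimum meets all of these because
  -- `μ < ρ`, `c < 1` and `μ < 1-ρ < c`.
  set e := min (c - μ) (1 - ρ) with he
  have he0 : 0 ≤ e := le_min (by linarith) (by linarith)
  have he1 : e ≤ c - μ := min_le_left _ _
  have he2 : e ≤ 1 - ρ := min_le_right _ _
  have he3 : c - ρ < e := lt_min (by linarith) (by linarith)
  refine ⟨betaInt (ρ + e - c) (θ - e + c) * betaInt (c + ρ - 1) (2 - c - ρ),
    mul_nonneg (betaInt_nonneg _ _) (betaInt_nonneg _ _), fun r hr hr1 => ?_⟩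
  have h1 := (intLe_beta (p := ρ + e - c) (q := θ - e + c) (by linarith) (by linarith)
    one_pos).mono (f := fun x => x ^ (-c) * ((r + x) ^ (ρ - 1) * (1 + x) ^ (-(θ + ρ))))
    (M := r ^ (-e)) (by positivity) (continuousOn_rpow_Ioi.mul
      ((continuousOn_add_rpow hr).mul (continuousOn_add_rpow one_pos)))
    (fun x hx => by positivity) fun x hx => ?_
  · have h2 := (intLe_beta (p := c + ρ - 1) (q := 2 - c - ρ) (by linarith) (by linarith) hr).mono
      (f := fun x => x ^ (c - 1) * (r * (x ^ (ρ - 1) * (r + x) ^ (-1 : ℝ)))) (M := r)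
      hr.le (continuousOn_rpow_Ioi.mul (continuousOn_const.mul
        (continuousOn_rpow_Ioi.mul (continuousOn_add_rpow hr))))
      (fun x hx => by positivity) (fun x hx => le_of_eq (by
        rw [show c + ρ - 1 + (2 - c - ρ) = 1 by ring,
          show c + ρ - 1 - 1 = (c - 1) + (ρ - 1) by ring, Real.rpow_add hx]; ring))
    have hb1 := betaInt_nonneg (ρ + e - c) (θ - e + c)
    have hb2 := betaInt_nonneg (c + ρ - 1) (2 - c - ρ)
    refine PairLe.of_intLe (by positivity) h1 h2 (fun x hx => by positivity) ?_
    have h3 : r ^ (-e + (1 + -(2 - c - ρ))) ≤ r ^ (ρ + μ - 1) :=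
      rpow_le_rpow_of_le_one hr hr1 (by linarith)
    rw [Real.rpow_add hr, Real.rpow_add hr, Real.rpow_one] at h3
    rw [Real.one_rpow]
    calc _ = betaInt (ρ + e - c) (θ - e + c) * betaInt (c + ρ - 1) (2 - c - ρ) *
          (r ^ (-e) * (r * r ^ (-(2 - c - ρ)))) := by ring
      _ ≤ _ := by gcongr
  · have h4 : (r + x) ^ (ρ - 1) ≤ r ^ (-e) * x ^ (ρ - 1 + e) :=
      calc (r + x) ^ (ρ - 1) = (r + x) ^ (-e) * (r + x) ^ (ρ - 1 + e) := by
            rw [← Real.rpow_add (by positivity)]; congr 1; ring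
        _ ≤ r ^ (-e) * x ^ (ρ - 1 + e) := mul_le_mul
            (Real.rpow_le_rpow_of_nonpos hr (by linarith) (by linarith))
            (Real.rpow_le_rpow_of_nonpos hx (by linarith) (by linarith))
            (by positivity) (by positivity)
    calc x ^ (-c) * ((r + x) ^ (ρ - 1) * (1 + x) ^ (-(θ + ρ)))
        ≤ x ^ (-c) * ((r ^ (-e) * x ^ (ρ - 1 + e)) * (1 + x) ^ (-(θ + ρ))) := by
          refine mul_le_mul_of_nonneg_left ?_ (by positivity)
          exact mul_le_mul_of_nonneg_right h4 (by positivity)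
      _ = r ^ (-e) * ((x ^ (-c) * x ^ (ρ - 1 + e)) * (1 + x) ^ (-(θ + ρ))) := by ring
      _ = _ := by
          rw [← Real.rpow_add hx, show -c + (ρ - 1 + e) = ρ + e - c - 1 by ring,
            show ρ + e - c + (θ - e + c) = θ + ρ by ring]

/-- The bound obtained is of order `r^(2ρ-1)`, and `μ < ρ` with `r ≤ 1` turns it into `r^(ρ+μ-1)`.
-/
theorem intLe_diag_small_two (hρ₀ : 0 < ρ) (hρ₁ : ρ < 1) (hθ : 0 < θ) (hμ : μ < ρ) {r : ℝ}
    (hr : 0 < r) (hr1 : r ≤ 1) :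
    IntLe (fun x => (r + x) ^ (ρ - 1) * (1 + x) ^ (-(θ + ρ)) *
      (r * (x ^ (ρ - 1) * (r + x) ^ (-1 : ℝ)))) (betaInt ρ (1 - ρ) * r ^ (ρ + μ - 1)) := by
  have h1 := intLe_beta (p := ρ) (q := 1 - ρ) hρ₀ (by linarith) hr
  have h2 := h1.mono (f := fun x => (r + x) ^ (ρ - 1) * (1 + x) ^ (-(θ + ρ)) *
      (r * (x ^ (ρ - 1) * (r + x) ^ (-1 : ℝ))))
    (M := r ^ (ρ - 1) * r) (by positivity)
    (((continuousOn_add_rpow hr).mul (continuousOn_add_rpow one_pos)).mul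
      (continuousOn_const.mul (continuousOn_rpow_Ioi.mul (continuousOn_add_rpow hr))))
    (fun x hx => by positivity) fun x hx => ?_
  · refine h2.le ?_
    have h3 : r ^ ((ρ - 1) + (1 + -(1 - ρ))) ≤ r ^ (ρ + μ - 1) :=
      rpow_le_rpow_of_le_one hr hr1 (by linarith)
    rw [Real.rpow_add hr, Real.rpow_add hr, Real.rpow_one] at h3
    have hb := betaInt_nonneg ρ (1 - ρ)
    calc _ = betaInt ρ (1 - ρ) * (r ^ (ρ - 1) * (r * r ^ (-(1 - ρ)))) := by ring
      _ ≤ _ := by gcongr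
  · rw [show ρ + (1 - ρ) = 1 by ring, mul_assoc (r ^ (ρ - 1)) r]
    refine mul_le_mul_of_nonneg_right ?_ (by positivity)
    calc (r + x) ^ (ρ - 1) * (1 + x) ^ (-(θ + ρ)) ≤ (r + x) ^ (ρ - 1) :=
          mul_le_of_le_one_right (by positivity)
            (Real.rpow_le_one_of_one_le_of_nonpos (by linarith) (by linarith))
      _ ≤ r ^ (ρ - 1) := Real.rpow_le_rpow_of_nonpos hr (by linarith) (by linarith)

end

/-! #### The resulting envelope bounds -/

section

variable {α ρ θ μ : ℝ}

/-- The weight `b = α` is the smallest that the kernel bound admits, and it lies below `θ`; `a =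
θ-α` lies in `(0,θ)` and below `1-α`. For `r ≥ 1` all three terms decay faster than the stated rate.
-/
theorem exists_envelope_crude_one (hα₀ : 0 < α) (hα₁ : α < 1) (hθ : α < θ) (hθ₁ : θ < 1) :
    ∃ A : ℝ, 0 ≤ A ∧ ∀ r > 0,
      Envelope (θ - α) α (fun x => (r + x) ^ (-(θ + 2))) (fun x => (1 + x) ^ (-θ)) ∧
      (1 ≤ r → envInt (θ - α) α (fun x => (r + x) ^ (-(θ + 2))) (fun x => (1 + x) ^ (-θ)) ≤
        A * r ^ (-(1 + θ - α))) := by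
  obtain ⟨A₁, hA₁, h₁⟩ := pairLe_crude_one (c := θ - α) (θ := θ) (by linarith) (by linarith)
    (by linarith)
  obtain ⟨A₂, hA₂, h₂⟩ := pairLe_crude_one (c := α) (θ := θ) hα₀ hα₁ hθ
  have hb := betaInt_nonneg 1 (θ + 1)
  refine ⟨A₁ + A₂ + betaInt 1 (θ + 1), by positivity, fun r hr => ?_⟩
  obtain ⟨hE, hI⟩ := Envelope.of_pairLe (h₁ r hr) (h₂ r hr)
    (intLe_diag_crude_one (by linarith) hr)
  refine ⟨hE, fun hr1 => hI.trans ?_⟩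
  rw [add_mul, add_mul]
  gcongr
  all_goals linarith

theorem exists_envelope_small_one (hα₀ : 0 < α) (hα₁ : α < 1) (hρ₁ : ρ < 1) (hθ : α < θ)
    (hθ₁ : θ < 1) :
    ∃ A : ℝ, 0 ≤ A ∧ ∀ r > 0,
      Envelope (θ - α) α (fun x => (r + x) ^ (ρ - 2))
        (fun x => r ^ (μ + θ) * (r + x) ^ (-θ)) ∧
      envInt (θ - α) α (fun x => (r + x) ^ (ρ - 2))
        (fun x => r ^ (μ + θ) * (r + x) ^ (-θ)) ≤ A * r ^ (ρ + μ - 1) := by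
  obtain ⟨A₁, hA₁, h₁⟩ := pairLe_small_one (c := θ - α) (θ := θ) (μ := μ) hρ₁ (by linarith)
    (by linarith) (by linarith)
  obtain ⟨A₂, hA₂, h₂⟩ := pairLe_small_one (c := α) (θ := θ) (μ := μ) hρ₁ hα₀ hα₁ hθ
  have hb := betaInt_nonneg 1 (1 - ρ)
  refine ⟨A₁ + A₂ + betaInt 1 (1 - ρ), by positivity, fun r hr => ?_⟩
  obtain ⟨hE, hI⟩ := Envelope.of_pairLe (h₁ r hr) (h₂ r hr)
    (intLe_diag_small_one hρ₁ (by linarith) hr)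
  refine ⟨hE, hI.trans ?_⟩
  rw [add_mul, add_mul]

/-- The weight `a = 1-α` is the largest that the kernel bound admits, and it gives exactly the rate
`r^(-(θ+1-α))`. The weight `b` has to lie in `[α,1)` and above `1-ρ`, which the maximum achieves. -/
theorem exists_envelope_crude_two (hα₀ : 0 < α) (hα₁ : α < 1) (hρ : α < ρ) (hθ : 0 < θ) :
    ∃ A : ℝ, 0 ≤ A ∧ ∀ r > 0,
      Envelope (1 - α) (max α (1 - α)) (fun x => (r + x) ^ (-(θ + 1)))
        (fun x => x ^ (ρ - 1) * (1 + x) ^ (-(θ + ρ))) ∧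
      (1 ≤ r → envInt (1 - α) (max α (1 - α)) (fun x => (r + x) ^ (-(θ + 1)))
        (fun x => x ^ (ρ - 1) * (1 + x) ^ (-(θ + ρ))) ≤ A * r ^ (-(1 + θ - α))) := by
  have hm : 1 - α ≤ max α (1 - α) := le_max_right _ _
  obtain ⟨A₁, hA₁, h₁⟩ := pairLe_crude_two (c := 1 - α) (ρ := ρ) hθ (by linarith)
    (by linarith) (by linarith)
  obtain ⟨A₂, hA₂, h₂⟩ := pairLe_crude_two (c := max α (1 - α)) (ρ := ρ) hθ (by linarith)
    (by linarith) (max_lt hα₁ (by linarith))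
  have hb := betaInt_nonneg ρ θ
  refine ⟨A₁ + A₂ + betaInt ρ θ, by positivity, fun r hr => ?_⟩
  obtain ⟨hE, hI⟩ := Envelope.of_pairLe (h₁ r hr) (h₂ r hr)
    (intLe_diag_crude_two (by linarith) hθ hr)
  refine ⟨hE, fun hr1 => hI.trans ?_⟩
  rw [add_mul, add_mul]
  gcongr
  all_goals linarith

theorem exists_envelope_small_two (hα₀ : 0 < α) (hα₁ : α < 1) (hρ : α < ρ) (hρ₁ : ρ < 1)
    (hθ : 0 < θ) (hμ : μ < ρ) (hμ' : μ < 1 - ρ) :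
    ∃ A : ℝ, 0 ≤ A ∧ ∀ r > 0, r ≤ 1 →
      Envelope (1 - α) (max α (1 - α)) (fun x => (r + x) ^ (ρ - 1) * (1 + x) ^ (-(θ + ρ)))
        (fun x => r * (x ^ (ρ - 1) * (r + x) ^ (-1 : ℝ))) ∧
      envInt (1 - α) (max α (1 - α)) (fun x => (r + x) ^ (ρ - 1) * (1 + x) ^ (-(θ + ρ)))
        (fun x => r * (x ^ (ρ - 1) * (r + x) ^ (-1 : ℝ))) ≤ A * r ^ (ρ + μ - 1) := by
  have hm : 1 - α ≤ max α (1 - α) := le_max_right _ _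
  obtain ⟨A₁, hA₁, h₁⟩ := pairLe_small_two (c := 1 - α) (ρ := ρ) (μ := μ) hρ₁ hθ hμ
    hμ' (by linarith) (by linarith)
  obtain ⟨A₂, hA₂, h₂⟩ := pairLe_small_two (c := max α (1 - α)) (ρ := ρ) (μ := μ)
    hρ₁ hθ hμ hμ' (by linarith) (max_lt hα₁ (by linarith))
  have hb := betaInt_nonneg ρ (1 - ρ)
  refine ⟨A₁ + A₂ + betaInt ρ (1 - ρ), by positivity, fun r hr hr1 => ?_⟩
  obtain ⟨hE, hI⟩ := Envelope.of_pairLe (h₁ r hr hr1) (h₂ r hr hr1)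
    (intLe_diag_small_two (by linarith) hρ₁ hθ hμ hr hr1)
  refine ⟨hE, hI.trans ?_⟩
  rw [add_mul, add_mul]

end

/-! ### Pointwise bounds in the function spaces -/

/-- Regularity and pointwise bounds of a function of norm at most `g`. -/
structure LapBound (ρ θ g : ℝ) (G : ℝ → ℝ) : Prop where
  nonneg : 0 ≤ g
  hasDerivAt : ∀ x > 0, HasDerivAt G (deriv G x) x
  hasDerivAt_deriv : ∀ x > 0, HasDerivAt (deriv G) (iteratedDeriv 2 G x) x
  continuousOn_snd : ContinuousOn (iteratedDeriv 2 G) (Ioi 0)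
  bound₀ : ∀ x > 0, |G x| ≤ g * (1 + x) ^ (-θ)
  bound₁ : ∀ x > 0, |deriv G x| ≤ g * (x ^ (ρ - 1) * (1 + x) ^ (-(θ + ρ)))
  bound₂ : ∀ x > 0, |iteratedDeriv 2 G x| ≤ g * (x ^ (ρ - 2) * (1 + x) ^ (-(θ + ρ)))

theorem le_of_lapSeminorm_le {ρ μ χ g : ℝ} {k : ℕ} {G : ℝ → ℝ} (hg : 0 ≤ g)
    (h : lapSeminorm ρ k μ χ G ≤ ENNReal.ofReal g) {x : ℝ} (hx : 0 < x) :
    |iteratedDeriv k G x| ≤ g * (x ^ (ρ + μ - k) * (1 + x) ^ (-(χ + μ + ρ))) := by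
  have h1 : ENNReal.ofReal ((1 + x) ^ (χ + μ + ρ) * x ^ ((k : ℝ) - ρ - μ) *
      |iteratedDeriv k G x|) ≤ ENNReal.ofReal g :=
    (le_iSup₂ (f := fun (q : ℝ) (_ : 0 < q) => ENNReal.ofReal ((1 + q) ^ (χ + μ + ρ) *
      q ^ ((k : ℝ) - ρ - μ) * |iteratedDeriv k G q|)) x hx).trans h
  rw [ENNReal.ofReal_le_ofReal_iff hg] at h1
  have h2 : (1 + x) ^ (χ + μ + ρ) * (1 + x) ^ (-(χ + μ + ρ)) = 1 := by
    rw [← Real.rpow_add (by linarith)]; simp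
  have h3 : x ^ ((k : ℝ) - ρ - μ) * x ^ (ρ + μ - k) = 1 := by
    rw [← Real.rpow_add hx, show (k : ℝ) - ρ - μ + (ρ + μ - k) = 0 by ring, Real.rpow_zero]
  calc |iteratedDeriv k G x| = ((1 + x) ^ (χ + μ + ρ) * x ^ ((k : ℝ) - ρ - μ) *
        |iteratedDeriv k G x|) * (x ^ (ρ + μ - k) * (1 + x) ^ (-(χ + μ + ρ))) := by
        linear_combination (-|iteratedDeriv k G x|) * h2 +
          (-(1 + x) ^ (χ + μ + ρ) * (1 + x) ^ (-(χ + μ + ρ)) * |iteratedDeriv k G x|) * h3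
    _ ≤ _ := by
        refine mul_le_mul_of_nonneg_right h1 ?_
        have : 0 < 1 + x := by linarith
        positivity

theorem lapSeminorm_le_of_le {ρ μ χ g : ℝ} {k : ℕ} {G : ℝ → ℝ}
    (h : ∀ x > 0, |iteratedDeriv k G x| ≤ g * (x ^ (ρ + μ - k) * (1 + x) ^ (-(χ + μ + ρ)))) :
    lapSeminorm ρ k μ χ G ≤ ENNReal.ofReal g := by
  refine iSup₂_le fun x hx => ENNReal.ofReal_le_ofReal ?_
  have h0 : 0 < 1 + x := by linarith
  have h2 : (1 + x) ^ (χ + μ + ρ) * (1 + x) ^ (-(χ + μ + ρ)) = 1 := by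
    rw [← Real.rpow_add (by linarith)]; simp
  have h3 : x ^ ((k : ℝ) - ρ - μ) * x ^ (ρ + μ - k) = 1 := by
    rw [← Real.rpow_add hx, show (k : ℝ) - ρ - μ + (ρ + μ - k) = 0 by ring, Real.rpow_zero]
  calc _ ≤ (1 + x) ^ (χ + μ + ρ) * x ^ ((k : ℝ) - ρ - μ) *
        (g * (x ^ (ρ + μ - k) * (1 + x) ^ (-(χ + μ + ρ)))) :=
        mul_le_mul_of_nonneg_left (h x hx) (by positivity)
    _ = g := by
        linear_combination g * h2 + (g * (1 + x) ^ (χ + μ + ρ) * (1 + x) ^ (-(χ + μ + ρ))) * h3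

theorem lapNorm_two (ρ μ χ : ℝ) (G : ℝ → ℝ) : lapNorm ρ 2 μ χ G =
    lapSeminorm ρ 0 (-ρ) χ G + (lapSeminorm ρ 1 μ χ G + lapSeminorm ρ 2 μ χ G) := by
  rw [lapNorm, show Finset.Icc 1 2 = {1, 2} from rfl, Finset.sum_pair (by norm_num)]

/-- The full norm, finite by membership, serves as a common bound for the three seminorms. -/
theorem LapBound.of_mem {ρ θ : ℝ} {G : ℝ → ℝ} (hG : G ∈ lapSpace ρ 2 0 θ) :
    LapBound ρ θ (lapNorm ρ 2 0 θ G).toReal G := by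
  obtain ⟨hc, -, hn⟩ := hG
  set g := (lapNorm ρ 2 0 θ G).toReal with hg
  have hg0 : 0 ≤ g := ENNReal.toReal_nonneg
  have hgn : lapNorm ρ 2 0 θ G = ENNReal.ofReal g := (ENNReal.ofReal_toReal hn.ne).symm
  have hs : lapSeminorm ρ 0 (-ρ) θ G ≤ ENNReal.ofReal g ∧
      lapSeminorm ρ 1 0 θ G ≤ ENNReal.ofReal g ∧ lapSeminorm ρ 2 0 θ G ≤ ENNReal.ofReal g := by
    rw [← hgn, lapNorm_two]
    refine ⟨le_self_add, le_add_of_nonneg_of_le zero_le le_self_add,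
      le_add_of_nonneg_of_le zero_le le_add_self⟩
  have hd : DifferentiableOn ℝ G (Ioi 0) := hc.differentiableOn (by norm_num)
  have hc1 : ContDiffOn ℝ 1 (deriv G) (Ioi 0) :=
    ((contDiffOn_succ_iff_deriv_of_isOpen (n := 1) isOpen_Ioi).1
      (by rw [one_add_one_eq_two]; simpa using hc)).2.2
  have hc2 : ContDiffOn ℝ 0 (deriv (deriv G)) (Ioi 0) :=
    ((contDiffOn_succ_iff_deriv_of_isOpen (n := 0) isOpen_Ioi).1 (by simpa using hc1)).2.2
  have hi : iteratedDeriv 2 G = deriv (deriv G) := by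
    rw [iteratedDeriv_succ, iteratedDeriv_one]
  refine ⟨hg0, fun x hx => (hd.differentiableAt (Ioi_mem_nhds hx)).hasDerivAt, fun x hx => ?_,
    ?_, fun x hx => ?_, fun x hx => ?_, fun x hx => ?_⟩
  · rw [hi]
    exact ((hc1.differentiableOn (by norm_num)).differentiableAt (Ioi_mem_nhds hx)).hasDerivAt
  · rw [hi]; exact hc2.continuousOn
  · have := le_of_lapSeminorm_le hg0 hs.1 hx
    simpa using this
  · have := le_of_lapSeminorm_le hg0 hs.2.1 hx
    simpa using this
  · have := le_of_lapSeminorm_le hg0 hs.2.2 hx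
    simpa using this

theorem rpow_neg_le_two_mul {θ r y : ℝ} (hθ₀ : 0 < θ) (hθ₁ : θ < 1) (hr : 0 < r) (hy : 0 < y)
    (h : y ≤ 2 * r) : r ^ (-θ) ≤ 2 * y ^ (-θ) := by
  have h1 : (2 * r) ^ (-θ) ≤ y ^ (-θ) := Real.rpow_le_rpow_of_nonpos hy h (by linarith)
  rw [Real.mul_rpow zero_le_two hr.le] at h1
  have h2 : (2 : ℝ)⁻¹ ≤ 2 ^ (-θ) := by
    rw [← Real.rpow_neg_one]
    exact Real.rpow_le_rpow_of_exponent_le one_le_two (by linarith)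
  have h3 : 0 < r ^ (-θ) := by positivity
  nlinarith

theorem rpow_weight_anti {ρ θ s x y : ℝ} (hρ₀ : 0 < ρ) (hθ : 0 < θ) (hs : s ≤ 0)
    (hx : 0 < x) (hxy : x ≤ y) :
    y ^ s * (1 + y) ^ (-(θ + ρ)) ≤ x ^ s * (1 + x) ^ (-(θ + ρ)) := by
  have hy : 0 < y := by linarith
  exact mul_le_mul (Real.rpow_le_rpow_of_nonpos hx hxy hs)
    (Real.rpow_le_rpow_of_nonpos (by linarith) (by linarith) (by linarith))
    (by positivity) (by positivity)

namespace LapBound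

variable {ρ θ μ g r x : ℝ} {G : ℝ → ℝ}

theorem continuousOn_fst (hG : LapBound ρ θ g G) : ContinuousOn (deriv G) (Ioi 0) := fun x hx =>
  (hG.hasDerivAt_deriv x hx).continuousAt.continuousWithinAt

theorem continuousOn (hG : LapBound ρ θ g G) : ContinuousOn G (Ioi 0) := fun x hx =>
  (hG.hasDerivAt x hx).continuousAt.continuousWithinAt

theorem abs_snd_le_small (hG : LapBound ρ θ g G) (hρ₀ : 0 < ρ) (hθ : 0 < θ) (hx : 0 < x) :
    |iteratedDeriv 2 G x| ≤ g * x ^ (ρ - 2) := by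
  refine (hG.bound₂ x hx).trans (mul_le_mul_of_nonneg_left ?_ hG.nonneg)
  exact mul_le_of_le_one_right (by positivity)
    (Real.rpow_le_one_of_one_le_of_nonpos (by linarith) (by linarith))

theorem abs_snd_le_crude (hG : LapBound ρ θ g G) (hρ₀ : 0 < ρ) (hθ : 0 < θ) (hx : 0 < x) :
    |iteratedDeriv 2 G x| ≤ g * x ^ (-(θ + 2)) := by
  refine (hG.bound₂ x hx).trans (mul_le_mul_of_nonneg_left ?_ hG.nonneg)
  calc x ^ (ρ - 2) * (1 + x) ^ (-(θ + ρ)) ≤ x ^ (ρ - 2) * x ^ (-(θ + ρ)) :=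
        mul_le_mul_of_nonneg_left (one_add_rpow_neg_le hx (by linarith) le_rfl) (by positivity)
    _ = _ := by rw [← Real.rpow_add hx]; congr 1; ring

theorem abs_fst_le_crude (hG : LapBound ρ θ g G) (hρ₀ : 0 < ρ) (hθ : 0 < θ) (hx : 0 < x) :
    |deriv G x| ≤ g * x ^ (-(θ + 1)) := by
  refine (hG.bound₁ x hx).trans (mul_le_mul_of_nonneg_left ?_ hG.nonneg)
  calc x ^ (ρ - 1) * (1 + x) ^ (-(θ + ρ)) ≤ x ^ (ρ - 1) * x ^ (-(θ + ρ)) :=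
        mul_le_mul_of_nonneg_left (one_add_rpow_neg_le hx (by linarith) le_rfl) (by positivity)
    _ = _ := by rw [← Real.rpow_add hx]; congr 1; ring

/-- The shift is kept only in the singular factor, which leaves a decaying weight free of `r`. -/
theorem abs_fst_shift_le_small (hG : LapBound ρ θ g G) (hρ₀ : 0 < ρ) (hθ : 0 < θ) (hr : 0 < r)
    (hx : 0 < x) :
    |deriv G (r + x)| ≤ g * ((r + x) ^ (ρ - 1) * (1 + x) ^ (-(θ + ρ))) := by
  refine (hG.bound₁ (r + x) (by linarith)).trans (mul_le_mul_of_nonneg_left ?_ hG.nonneg)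
  refine mul_le_mul_of_nonneg_left ?_ (by positivity)
  exact Real.rpow_le_rpow_of_nonpos (by linarith) (by linarith) (by linarith)

theorem abs_sub_le_crude (hG : LapBound ρ θ g G) (hθ : 0 < θ) (hr : 0 < r) (hx : 0 < x) :
    |G x - G (x + r)| ≤ 2 * g * (1 + x) ^ (-θ) := by
  have h1 := hG.bound₀ x hx
  have h2 := hG.bound₀ (x + r) (by linarith)
  have h3 : (1 + (x + r)) ^ (-θ) ≤ (1 + x) ^ (-θ) :=
    Real.rpow_le_rpow_of_nonpos (by linarith) (by linarith) (by linarith)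
  have h4 := mul_le_mul_of_nonneg_left h3 hG.nonneg
  refine (abs_sub _ _).trans ?_
  linarith

theorem abs_deriv_sub_le_crude (hG : LapBound ρ θ g G) (hρ₀ : 0 < ρ) (hρ₁ : ρ < 1) (hθ : 0 < θ)
    (hr : 0 < r) (hx : 0 < x) :
    |deriv G x - deriv G (x + r)| ≤ 2 * g * (x ^ (ρ - 1) * (1 + x) ^ (-(θ + ρ))) := by
  have h1 := hG.bound₁ x hx
  have h2 := hG.bound₁ (x + r) (by linarith)
  have h3 := rpow_weight_anti (s := ρ - 1) (y := x + r) hρ₀ hθ (by linarith) hx (by linarith)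
  have h4 := mul_le_mul_of_nonneg_left h3 hG.nonneg
  refine (abs_sub _ _).trans ?_
  linarith

theorem abs_sub_le_mul (hG : LapBound ρ θ g G) (hρ₀ : 0 < ρ) (hρ₁ : ρ < 1) (hθ : 0 < θ)
    (hr : 0 < r) (hx : 0 < x) :
    |G x - G (x + r)| ≤ g * (x ^ (ρ - 1) * (1 + x) ^ (-(θ + ρ))) * r := by
  have h := (convex_Icc x (x + r)).norm_image_sub_le_of_norm_hasDerivWithin_le
    (f := G) (f' := deriv G) (C := g * (x ^ (ρ - 1) * (1 + x) ^ (-(θ + ρ))))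
    (fun y hy => (hG.hasDerivAt y (hx.trans_le hy.1)).hasDerivWithinAt)
    (fun y hy => (hG.bound₁ y (hx.trans_le hy.1)).trans (mul_le_mul_of_nonneg_left
      (rpow_weight_anti hρ₀ hθ (by linarith) hx hy.1) hG.nonneg))
    (right_mem_Icc.2 (by linarith)) (left_mem_Icc.2 (by linarith))
  rwa [Real.norm_eq_abs, Real.norm_eq_abs, show x - (x + r) = -r by ring, abs_neg,
    abs_of_pos hr] at h

theorem abs_deriv_sub_le_mul (hG : LapBound ρ θ g G) (hρ₀ : 0 < ρ) (hρ₁ : ρ < 1) (hθ : 0 < θ)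
    (hr : 0 < r) (hx : 0 < x) :
    |deriv G x - deriv G (x + r)| ≤ g * x ^ (ρ - 2) * r := by
  have h := (convex_Icc x (x + r)).norm_image_sub_le_of_norm_hasDerivWithin_le
    (f := deriv G) (f' := iteratedDeriv 2 G) (C := g * x ^ (ρ - 2))
    (fun y hy => (hG.hasDerivAt_deriv y (hx.trans_le hy.1)).hasDerivWithinAt)
    (fun y hy => (hG.abs_snd_le_small hρ₀ hθ (hx.trans_le hy.1)).trans
      (mul_le_mul_of_nonneg_left (Real.rpow_le_rpow_of_nonpos hx hy.1 (by linarith)) hG.nonneg))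
    (right_mem_Icc.2 (by linarith)) (left_mem_Icc.2 (by linarith))
  rwa [Real.norm_eq_abs, Real.norm_eq_abs, show x - (x + r) = -r by ring, abs_neg,
    abs_of_pos hr] at h

/-- Since `|G'(y)| ≤ g y^(ρ-1)`, the increment is at most `g/ρ ((x+r)^ρ - x^ρ)`, and `t ↦ t^ρ` is
subadditive. -/
theorem abs_sub_le_rpow (hG : LapBound ρ θ g G) (hρ₀ : 0 < ρ) (hρ₁ : ρ < 1) (hθ : 0 < θ)
    (hr : 0 < r) (hx : 0 < x) : |G x - G (x + r)| ≤ g / ρ * r ^ ρ := by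
  have h := image_norm_le_of_norm_deriv_right_le_deriv_boundary' (a := x) (b := x + r)
    (f := fun y => G y - G x) (f' := deriv G) (B := fun y => g / ρ * (y ^ ρ - x ^ ρ))
    (B' := fun y => g * y ^ (ρ - 1))
    ((hG.continuousOn.mono fun y hy => hx.trans_le hy.1).sub continuousOn_const)
    (fun y hy => ((hG.hasDerivAt y (hx.trans_le hy.1)).sub_const _).hasDerivWithinAt)
    (by simp)
    (continuousOn_const.mul ((continuousOn_rpow_Ioi.mono fun y hy => hx.trans_le hy.1).sub
      continuousOn_const))
    (fun y hy => by
      have hy0 : 0 < y := hx.trans_le hy.1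
      have h1 := ((Real.hasDerivAt_rpow_const (p := ρ) (Or.inl hy0.ne')).sub_const
        (x ^ ρ)).const_mul (g / ρ)
      refine HasDerivAt.hasDerivWithinAt (h1.congr_deriv ?_)
      field_simp)
    (fun y hy => by
      have hy0 : 0 < y := hx.trans_le hy.1
      refine (hG.bound₁ y hy0).trans (mul_le_mul_of_nonneg_left ?_ hG.nonneg)
      exact mul_le_of_le_one_right (by positivity)
        (Real.rpow_le_one_of_one_le_of_nonpos (by linarith) (by linarith)))
    (right_mem_Icc.2 (by linarith))
  have h2 : (x + r) ^ ρ ≤ x ^ ρ + r ^ ρ := by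
    have := NNReal.rpow_add_le_add_rpow ⟨x, hx.le⟩ ⟨r, hr.le⟩ hρ₀.le hρ₁.le
    exact_mod_cast this
  rw [abs_sub_comm, ← Real.norm_eq_abs]
  refine h.trans (mul_le_mul_of_nonneg_left (by linarith) (div_nonneg hG.nonneg hρ₀.le))

/-- For `x ≤ r` the Hölder bound `r^ρ ≤ r^μ` is used, and for `x ≥ r` the mean value bound. In each
range the larger of `x` and `r` is comparable to `r + x`, which gives a single homogeneous
expression. -/
theorem abs_sub_le_small (hG : LapBound ρ θ g G) (hρ₀ : 0 < ρ) (hρ₁ : ρ < 1) (hθ₀ : 0 < θ)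
    (hθ : θ < ρ) (hμ₀ : 0 ≤ μ) (hμ : μ < ρ) (hμ' : μ < 1 - ρ) (hr : 0 < r) (hr1 : r ≤ 1)
    (hx : 0 < x) :
    |G x - G (x + r)| ≤ 2 / ρ * g * (r ^ (μ + θ) * (r + x) ^ (-θ)) := by
  have hg := hG.nonneg
  rcases le_total x r with h | h
  · have h1 := hG.abs_sub_le_rpow hρ₀ hρ₁ hθ₀ hr hx
    have h2 : r ^ ρ ≤ r ^ μ := rpow_le_rpow_of_le_one hr hr1 hμ.le
    have h3 : r ^ (-θ) ≤ 2 * (r + x) ^ (-θ) :=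
      rpow_neg_le_two_mul hθ₀ (by linarith) hr (by linarith : 0 < r + x) (by linarith)
    calc |G x - G (x + r)| ≤ g / ρ * r ^ μ := h1.trans (by gcongr)
      _ = g / ρ * (r ^ (μ + θ) * r ^ (-θ)) := by
          rw [← Real.rpow_add hr]; congr 2; ring
      _ ≤ g / ρ * (r ^ (μ + θ) * (2 * (r + x) ^ (-θ))) := by gcongr
      _ = _ := by ring
  · have h1 := hG.abs_sub_le_mul hρ₀ hρ₁ hθ₀ hr hx
    have h2 : x ^ (ρ - 1) * (1 + x) ^ (-(θ + ρ)) ≤ x ^ (μ - 1) :=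
      calc x ^ (ρ - 1) * (1 + x) ^ (-(θ + ρ)) ≤ x ^ (ρ - 1) * x ^ (-(ρ - μ)) := by
            refine mul_le_mul_of_nonneg_left ?_ (by positivity)
            exact one_add_rpow_neg_le hx (by linarith) (by linarith)
        _ = _ := by rw [← Real.rpow_add hx]; congr 1; ring
    have h3 : x ^ (-θ) ≤ 2 * (r + x) ^ (-θ) :=
      rpow_neg_le_two_mul hθ₀ (by linarith) hx (by linarith : 0 < r + x) (by linarith)
    -- The exponent `μ+θ-1` is negative, because `μ < 1-ρ` and `θ < ρ`, so `x ≥ r` allows `x` to be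
    -- replaced by `r`.
    have h4 : x ^ (μ - 1) * r ≤ r ^ (μ + θ) * x ^ (-θ) :=
      calc x ^ (μ - 1) * r = x ^ (-θ) * x ^ (μ + θ - 1) * r := by
            rw [← Real.rpow_add hx]; congr 2; ring
        _ ≤ x ^ (-θ) * r ^ (μ + θ - 1) * r := by
            gcongr ?_ * ?_ * _
            exact Real.rpow_le_rpow_of_nonpos hr h (by linarith)
        _ = x ^ (-θ) * (r ^ (μ + θ - 1) * r ^ (1 : ℝ)) := by rw [Real.rpow_one]; ring
        _ = _ := by rw [← Real.rpow_add hr, sub_add_cancel, mul_comm]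
    have h5 : 1 ≤ 1 / ρ := by rw [le_div_iff₀ hρ₀]; linarith
    calc |G x - G (x + r)| ≤ g * x ^ (μ - 1) * r := h1.trans (by gcongr)
      _ = 1 * g * (x ^ (μ - 1) * r) := by ring
      _ ≤ 1 / ρ * g * (r ^ (μ + θ) * (2 * (r + x) ^ (-θ))) := by
          exact mul_le_mul (mul_le_mul_of_nonneg_right h5 hg) (h4.trans (by gcongr))
            (by positivity) (by positivity)
      _ = _ := by ring

/-- This interpolates between the termwise bound `x^(ρ-1)` for `x ≤ r` and the mean value bound `r
x^(ρ-2)` for `x ≥ r`. -/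
theorem abs_deriv_sub_le_small (hG : LapBound ρ θ g G) (hρ₀ : 0 < ρ) (hρ₁ : ρ < 1) (hθ : 0 < θ)
    (hr : 0 < r) (hx : 0 < x) :
    |deriv G x - deriv G (x + r)| ≤ 4 * g * (r * (x ^ (ρ - 1) * (r + x) ^ (-1 : ℝ))) := by
  have hg := hG.nonneg
  rw [Real.rpow_neg_one]
  have hrx : 0 < r + x := by linarith
  rcases le_total x r with h | h
  · have h1 := hG.abs_deriv_sub_le_crude hρ₀ hρ₁ hθ hr hx
    have h2 : (1 + x) ^ (-(θ + ρ)) ≤ 1 :=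
      Real.rpow_le_one_of_one_le_of_nonpos (by linarith) (by linarith)
    have h3 : 1 ≤ 2 * (r * (r + x)⁻¹) := by
      rw [← div_eq_mul_inv, ← mul_div_assoc, le_div_iff₀ hrx]; linarith
    calc |deriv G x - deriv G (x + r)| ≤ 2 * g * (x ^ (ρ - 1) * 1) := h1.trans (by gcongr)
      _ ≤ 2 * g * (x ^ (ρ - 1) * (2 * (r * (r + x)⁻¹))) := by gcongr
      _ = _ := by ring
  · have h1 := hG.abs_deriv_sub_le_mul hρ₀ hρ₁ hθ hr hx
    have h2 : x ^ (ρ - 2) = x ^ (ρ - 1) * x⁻¹ := by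
      rw [← Real.rpow_neg_one, ← Real.rpow_add hx]; congr 1; ring
    have h3 : x⁻¹ ≤ 4 * (r + x)⁻¹ := by
      rw [← one_div, ← div_eq_mul_inv, div_le_div_iff₀ hx hrx]; linarith
    calc |deriv G x - deriv G (x + r)| ≤ g * (x ^ (ρ - 1) * x⁻¹) * r := by rw [← h2]; exact h1
      _ ≤ g * (x ^ (ρ - 1) * (4 * (r + x)⁻¹)) * r := by gcongr
      _ = _ := by ring

end LapBound

/-! ### Bounds and continuity of `N[G,H]` -/

section

variable {α ρ θ μ C g h r : ℝ} {Wc : ℂ → ℂ} {G H : ℝ → ℝ}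

theorem continuousOn_shift {f : ℝ → ℝ} (hf : ContinuousOn f (Ioi 0)) (hr : 0 < r) :
    ContinuousOn (fun x => f (r + x)) (Ioi 0) :=
  hf.comp (by fun_prop) fun x hx => by
    have : 0 < x := hx
    exact add_pos hr this

theorem continuousOn_sub_shift {f : ℝ → ℝ} (hf : ContinuousOn f (Ioi 0)) (hr : 0 < r) :
    ContinuousOn (fun x => f x - f (x + r)) (Ioi 0) :=
  hf.sub (hf.comp (by fun_prop) fun x hx => by
    have : 0 < x := hx
    exact add_pos this hr)

theorem continuousAt_shift {f : ℝ → ℝ} (hf : ContinuousOn f (Ioi 0)) (hr : 0 < r) {x : ℝ}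
    (hx : 0 < x) : ContinuousAt (fun r => f (r + x)) r :=
  ContinuousAt.comp (f := fun r => r + x) (hf.continuousAt (Ioi_mem_nhds (by linarith)))
    (by fun_prop)

theorem continuousAt_sub_shift {f : ℝ → ℝ} (hf : ContinuousOn f (Ioi 0)) (hr : 0 < r) {x : ℝ}
    (hx : 0 < x) : ContinuousAt (fun r => f x - f (x + r)) r :=
  continuousAt_const.sub (ContinuousAt.comp (f := fun r => x + r)
    (hf.continuousAt (Ioi_mem_nhds (by linarith))) (by fun_prop))

theorem kerIntegrable_integrand₁ (hK : KernelBound α C Wc) (hα₀ : 0 < α) (hα₁ : α < 1)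
    (hρ₀ : 0 < ρ) (hθ : α < θ) (hθ₁ : θ < 1) (hG : LapBound ρ θ g G) (hH : LapBound ρ θ h H)
    (hr : 0 < r) : KerIntegrable Wc (integrand₁ G H r) := by
  obtain ⟨A, -, hE⟩ := exists_envelope_crude_one hα₀ hα₁ hθ hθ₁
  exact hK.kerIntegrable_mul (by linarith) (by linarith) le_rfl (by linarith) (hE r hr).1
    (continuousOn_shift hG.continuousOn_snd hr) (continuousOn_sub_shift hH.continuousOn hr)
    (fun x hx => hG.abs_snd_le_crude hρ₀ (by linarith) (by linarith))
    (fun x hx => hH.abs_sub_le_crude (by linarith) hr hx)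

theorem kerIntegrable_integrand₂ (hK : KernelBound α C Wc) (hα₀ : 0 < α) (hα₁ : α < 1)
    (hρ : α < ρ) (hρ₁ : ρ < 1) (hθ : 0 < θ) (hG : LapBound ρ θ g G) (hH : LapBound ρ θ h H)
    (hr : 0 < r) : KerIntegrable Wc (integrand₂ G H r) := by
  obtain ⟨A, -, hE⟩ := exists_envelope_crude_two hα₀ hα₁ hρ hθ
  exact hK.kerIntegrable_mul (by linarith) le_rfl (le_max_left _ _)
    (max_le (by linarith) (by linarith)) (hE r hr).1
    (continuousOn_shift hG.continuousOn_fst hr) (continuousOn_sub_shift hH.continuousOn_fst hr)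
    (fun x hx => hG.abs_fst_le_crude (by linarith) hθ (by linarith))
    (fun x hx => hH.abs_deriv_sub_le_crude (by linarith) hρ₁ hθ hr hx)

/-- The crude envelope of `G''` decreases in its parameter, so the one at `r/2` dominates for all `s
> r/2`; that of the difference of `H` does not involve the parameter. -/
theorem continuousAt_kerIntegral_integrand₁ (hK : KernelBound α C Wc) (hα₀ : 0 < α)
    (hα₁ : α < 1) (hρ₀ : 0 < ρ) (hθ : α < θ) (hθ₁ : θ < 1) (hG : LapBound ρ θ g G)
    (hH : LapBound ρ θ h H) (hr : 0 < r) :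
    ContinuousAt (fun r => kerIntegral Wc (integrand₁ G H r)) r := by
  obtain ⟨A, -, hE⟩ := exists_envelope_crude_one hα₀ hα₁ hθ hθ₁
  refine hK.continuousAt_kerIntegral_mul (g := g) (h := 2 * h) (by linarith) (by linarith) le_rfl
    (by linarith) (hE (r / 2) (by linarith)).1 ?_ ?_
    (fun x hx => continuousAt_shift hG.continuousOn_snd hr hx)
    (fun x hx => continuousAt_sub_shift hH.continuousOn hr hx)
  · filter_upwards [Ioi_mem_nhds (show r / 2 < r by linarith)] with s hs
    have hs : r / 2 < s := hs
    refine ⟨continuousOn_shift hG.continuousOn_snd (by linarith), fun x hx => ?_⟩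
    refine (hG.abs_snd_le_crude hρ₀ (by linarith) (by linarith)).trans
      (mul_le_mul_of_nonneg_left ?_ hG.nonneg)
    exact Real.rpow_le_rpow_of_nonpos (by linarith) (by linarith) (by linarith)
  · filter_upwards [Ioi_mem_nhds hr] with s hs
    exact ⟨continuousOn_sub_shift hH.continuousOn hs,
      fun x hx => hH.abs_sub_le_crude (by linarith) hs hx⟩

theorem continuousAt_kerIntegral_integrand₂ (hK : KernelBound α C Wc) (hα₀ : 0 < α)
    (hα₁ : α < 1) (hρ : α < ρ) (hρ₁ : ρ < 1) (hθ : 0 < θ) (hG : LapBound ρ θ g G)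
    (hH : LapBound ρ θ h H) (hr : 0 < r) :
    ContinuousAt (fun r => kerIntegral Wc (integrand₂ G H r)) r := by
  obtain ⟨A, -, hE⟩ := exists_envelope_crude_two hα₀ hα₁ hρ hθ
  refine hK.continuousAt_kerIntegral_mul (g := g) (h := 2 * h) (by linarith) le_rfl
    (le_max_left _ _) (max_le (by linarith) (by linarith)) (hE (r / 2) (by linarith)).1 ?_ ?_
    (fun x hx => continuousAt_shift hG.continuousOn_fst hr hx)
    (fun x hx => continuousAt_sub_shift hH.continuousOn_fst hr hx)
  · filter_upwards [Ioi_mem_nhds (show r / 2 < r by linarith)] with s hs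
    have hs : r / 2 < s := hs
    refine ⟨continuousOn_shift hG.continuousOn_fst (by linarith), fun x hx => ?_⟩
    refine (hG.abs_fst_le_crude (by linarith) hθ (by linarith)).trans
      (mul_le_mul_of_nonneg_left ?_ hG.nonneg)
    exact Real.rpow_le_rpow_of_nonpos (by linarith) (by linarith) (by linarith)
  · filter_upwards [Ioi_mem_nhds hr] with s hs
    exact ⟨continuousOn_sub_shift hH.continuousOn_fst hs,
      fun x hx => hH.abs_deriv_sub_le_crude (by linarith) hρ₁ hθ hs hx⟩

theorem continuousOn_formN (hK : KernelBound α C Wc) (hα₀ : 0 < α) (hα₁ : α < 1) (hθ : α < θ)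
    (hθ₁ : θ < ρ) (hρ₁ : ρ < 1) (hG : LapBound ρ θ g G) (hH : LapBound ρ θ h H) :
    ContinuousOn (formN Wc G H) (Ioi 0) := by
  intro r hr
  have hr : 0 < r := hr
  have hinv : ContinuousAt (fun r : ℝ => 1 / r) r :=
    continuousAt_const.div continuousAt_id hr.ne'
  exact ((hinv.mul (continuousAt_kerIntegral_integrand₁ hK hα₀ hα₁ (by linarith) hθ
    (by linarith) hG hH hr)).add (hinv.mul (continuousAt_kerIntegral_integrand₂ hK hα₀ hα₁
    (by linarith) hρ₁ (by linarith) hG hH hr))).continuousWithinAt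

/-- The small envelopes serve for `r ≤ 1`, the crude ones for `r ≥ 1`; the prefactor `1/r` lowers
each exponent by one. -/
theorem exists_abs_formN_le (hK : KernelBound α C Wc) (hα₀ : 0 < α) (hα₁ : α < 1) (hθ : α < θ)
    (hθ₁ : θ < ρ) (hρ₁ : ρ < 1) (hμ₀ : 0 ≤ μ) (hμ : μ < ρ) (hμ' : μ < 1 - ρ) :
    ∃ A : ℝ, 0 ≤ A ∧ ∀ g h G H, LapBound ρ θ g G → LapBound ρ θ h H → ∀ r > 0,
      |formN Wc G H r| ≤ A * (g * h) * (r ^ (ρ + μ - 2) * (1 + r) ^ (-(θ - α + μ + ρ))) := by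
  have hC := hK.nonneg
  have hρ₀ : 0 < ρ := by linarith
  have hθ₀ : 0 < θ := by linarith
  obtain ⟨A₁, hA₁, h₁⟩ := exists_envelope_small_one (μ := μ) hα₀ hα₁ hρ₁ hθ (by linarith)
  obtain ⟨A₂, hA₂, h₂⟩ := exists_envelope_small_two (μ := μ) hα₀ hα₁ (hθ.trans hθ₁) hρ₁ hθ₀ hμ hμ'
  obtain ⟨A₃, hA₃, h₃⟩ := exists_envelope_crude_one hα₀ hα₁ hθ (by linarith)
  obtain ⟨A₄, hA₄, h₄⟩ := exists_envelope_crude_two hα₀ hα₁ (hθ.trans hθ₁) hθ₀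
  set s := θ - α + μ + ρ with hs
  set K := C * (2 / ρ * A₁ + 4 * A₂ + 2 * A₃ + 2 * A₄) with hKdef
  have hs0 : 0 < s := by linarith
  have hK0 : 0 ≤ K := by positivity
  -- The factor `2^s` pays for the weight: `1 + r ≤ 2` when `r ≤ 1`, and `1 + r ≤ 2r` when `r ≥ 1`.
  refine ⟨K * 2 ^ s, by positivity, fun g h G H hG hH r hr => ?_⟩
  have hg := hG.nonneg
  have hh := hH.nonneg
  have hm : max α (1 - α) ≤ 1 + α := max_le (by linarith) (by linarith)
  have h2s : (2 : ℝ) ^ s * 2 ^ (-s) = 1 := by rw [← Real.rpow_add two_pos]; simp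
  have hN : |formN Wc G H r| ≤ r⁻¹ * (|kerIntegral Wc (integrand₁ G H r)| +
      |kerIntegral Wc (integrand₂ G H r)|) := by
    rw [formN, formN₁, formN₂, ← mul_add, abs_mul, one_div, abs_of_pos (inv_pos.2 hr)]
    exact mul_le_mul_of_nonneg_left (abs_add_le _ _) (by positivity)
  have hstep : ∀ t : ℝ, r⁻¹ * r ^ t = r ^ (t - 1) := fun t => by
    rw [Real.rpow_sub_one hr.ne', div_eq_inv_mul]
  rcases le_total r 1 with hr1 | hr1
  · have e₁ : |kerIntegral Wc (integrand₁ G H r)| ≤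
        C * g * (2 / ρ * h) * (A₁ * r ^ (ρ + μ - 1)) :=
      (hK.abs_kerIntegral_mul_le (by linarith) (by linarith) le_rfl (by linarith) (h₁ r hr).1
        (fun x hx => hG.abs_snd_le_small hρ₀ hθ₀ (by linarith))
        (fun x hx => hH.abs_sub_le_small hρ₀ hρ₁ hθ₀ hθ₁ hμ₀ hμ hμ' hr hr1 hx)).trans
        (mul_le_mul_of_nonneg_left (h₁ r hr).2 (by positivity))
    have e₂ : |kerIntegral Wc (integrand₂ G H r)| ≤
        C * g * (4 * h) * (A₂ * r ^ (ρ + μ - 1)) :=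
      (hK.abs_kerIntegral_mul_le (by linarith) le_rfl (le_max_left _ _) hm (h₂ r hr hr1).1
        (fun x hx => hG.abs_fst_shift_le_small hρ₀ hθ₀ hr hx)
        (fun x hx => hH.abs_deriv_sub_le_small hρ₀ hρ₁ hθ₀ hr hx)).trans
        (mul_le_mul_of_nonneg_left (h₂ r hr hr1).2 (by positivity))
    have e₃ : (2 : ℝ) ^ (-s) ≤ (1 + r) ^ (-s) :=
      Real.rpow_le_rpow_of_nonpos (by linarith) (by linarith) (by linarith)
    calc |formN Wc G H r| ≤ r⁻¹ * (C * g * (2 / ρ * h) * (A₁ * r ^ (ρ + μ - 1)) +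
          C * g * (4 * h) * (A₂ * r ^ (ρ + μ - 1))) :=
          hN.trans (mul_le_mul_of_nonneg_left (add_le_add e₁ e₂) (by positivity))
      -- The zeros align this constant with `K` summand by summand.
      _ = C * (2 / ρ * A₁ + 4 * A₂ + 0 + 0) * (g * h) * (r⁻¹ * r ^ (ρ + μ - 1)) := by ring
      _ ≤ K * (g * h) * (r⁻¹ * r ^ (ρ + μ - 1)) := by rw [hKdef]; gcongr <;> positivity
      _ = K * (2 ^ s * 2 ^ (-s)) * (g * h) * r ^ (ρ + μ - 2) := by
          rw [h2s, hstep]; ring_nf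
      _ = K * 2 ^ s * (g * h) * (r ^ (ρ + μ - 2) * 2 ^ (-s)) := by ring
      _ ≤ _ := by gcongr
  · have e₁ : |kerIntegral Wc (integrand₁ G H r)| ≤
        C * g * (2 * h) * (A₃ * r ^ (-(1 + θ - α))) :=
      (hK.abs_kerIntegral_mul_le (by linarith) (by linarith) le_rfl (by linarith) (h₃ r hr).1
        (fun x hx => hG.abs_snd_le_crude hρ₀ hθ₀ (by linarith))
        (fun x hx => hH.abs_sub_le_crude hθ₀ hr hx)).trans
        (mul_le_mul_of_nonneg_left ((h₃ r hr).2 hr1) (by positivity))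
    have e₂ : |kerIntegral Wc (integrand₂ G H r)| ≤
        C * g * (2 * h) * (A₄ * r ^ (-(1 + θ - α))) :=
      (hK.abs_kerIntegral_mul_le (by linarith) le_rfl (le_max_left _ _) hm (h₄ r hr).1
        (fun x hx => hG.abs_fst_le_crude hρ₀ hθ₀ (by linarith))
        (fun x hx => hH.abs_deriv_sub_le_crude hρ₀ hρ₁ hθ₀ hr hx)).trans
        (mul_le_mul_of_nonneg_left ((h₄ r hr).2 hr1) (by positivity))
    have e₃ : r ^ (-s) * 2 ^ (-s) ≤ (1 + r) ^ (-s) := by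
      rw [← Real.mul_rpow hr.le zero_le_two]
      exact Real.rpow_le_rpow_of_nonpos (by linarith) (by linarith) (by linarith)
    calc |formN Wc G H r| ≤ r⁻¹ * (C * g * (2 * h) * (A₃ * r ^ (-(1 + θ - α))) +
          C * g * (2 * h) * (A₄ * r ^ (-(1 + θ - α)))) :=
          hN.trans (mul_le_mul_of_nonneg_left (add_le_add e₁ e₂) (by positivity))
      _ = C * (0 + 0 + 2 * A₃ + 2 * A₄) * (g * h) * (r⁻¹ * r ^ (-(1 + θ - α))) := by ring
      _ ≤ K * (g * h) * (r⁻¹ * r ^ (-(1 + θ - α))) := by rw [hKdef]; gcongr <;> positivity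
      _ = K * (2 ^ s * 2 ^ (-s)) * (g * h) * (r ^ (ρ + μ - 2) * r ^ (-s)) := by
          rw [h2s, hstep, ← Real.rpow_add hr, mul_one, hs]; ring_nf
      _ = K * 2 ^ s * (g * h) * (r ^ (ρ + μ - 2) * (r ^ (-s) * 2 ^ (-s))) := by ring
      _ ≤ _ := by gcongr

end

/-! ### Twofold tail integrals -/

/-- Near `x` the tail integral is a constant minus the integral from `x/2` to `p`, to which the
fundamental theorem of calculus applies. -/
theorem hasDerivAt_integral_Ioi {f : ℝ → ℝ} (hc : ContinuousOn f (Ioi 0))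
    (hi : ∀ a > 0, IntegrableOn f (Ioi a)) {x : ℝ} (hx : 0 < x) :
    HasDerivAt (fun p => ∫ t in Ioi p, f t) (-f x) x := by
  have hx2 : 0 < x / 2 := by linarith
  have h1 : HasDerivAt (fun u => ∫ t in (x / 2)..u, f t) (f x) x := by
    refine intervalIntegral.integral_hasDerivAt_right ?_ ?_ (hc.continuousAt (Ioi_mem_nhds hx))
    · refine ContinuousOn.intervalIntegrable (hc.mono ?_)
      rw [uIcc_of_le (by linarith)]
      exact fun y hy => hx2.trans_le hy.1
    · exact hc.stronglyMeasurableAtFilter isOpen_Ioi x hx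
  have h2 := h1.const_sub (∫ t in Ioi (x / 2), f t)
  refine h2.congr_of_eventuallyEq ?_
  filter_upwards [Ioi_mem_nhds hx] with p hp
  rw [← intervalIntegral.integral_interval_add_Ioi (hi _ hx2) (hi _ hp)]
  ring

theorem integrableOn_of_abs_le {f F : ℝ → ℝ} {s : Set ℝ} (hs : MeasurableSet s)
    (hc : ContinuousOn f s) (hF : IntegrableOn F s) (h : ∀ x ∈ s, |f x| ≤ F x) :
    IntegrableOn f s :=
  Integrable.mono' hF (hc.aestronglyMeasurable hs) <| by
    filter_upwards [ae_restrict_mem hs] with x hx using h x hx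

theorem abs_integral_le_of_abs_le {f F : ℝ → ℝ} {s : Set ℝ} (hs : MeasurableSet s)
    (hF : IntegrableOn F s) (h : ∀ x ∈ s, |f x| ≤ F x) : |∫ x in s, f x| ≤ ∫ x in s, F x :=
  norm_integral_le_of_norm_le (f := f) hF <| by
    filter_upwards [ae_restrict_mem hs] with x hx using h x hx

/-- A continuous function on `(0,∞)` with a bound that makes its twofold tail integral finite. -/
structure TailBound (σ δ M : ℝ) (f : ℝ → ℝ) : Prop where
  nonneg : 0 ≤ M
  continuousOn : ContinuousOn f (Ioi 0)
  bound : ∀ x > 0, |f x| ≤ M * (x ^ (σ - 2) * (1 + x) ^ (-(δ + σ)))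

namespace TailBound

variable {σ δ M : ℝ} {f : ℝ → ℝ}

theorem abs_le_at (hf : TailBound σ δ M f) (hσ₀ : 0 < σ) (hδ : 0 < δ) {p x : ℝ} (hp : 0 < p)
    (hx : p ≤ x) : |f x| ≤ M * (1 + p) ^ (-(δ + σ)) * x ^ (σ - 2) := by
  have hx0 : 0 < x := by linarith
  have hM := hf.nonneg
  have h1 : (1 + x) ^ (-(δ + σ)) ≤ (1 + p) ^ (-(δ + σ)) :=
    Real.rpow_le_rpow_of_nonpos (by linarith) (by linarith) (by linarith)
  calc |f x| ≤ M * (x ^ (σ - 2) * (1 + x) ^ (-(δ + σ))) := hf.bound x hx0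
    _ ≤ M * (x ^ (σ - 2) * (1 + p) ^ (-(δ + σ))) := by gcongr
    _ = _ := by ring

theorem integrableOn_Ioi (hf : TailBound σ δ M f) (hσ₀ : 0 < σ) (hσ₁ : σ < 1) (hδ : 0 < δ) {p : ℝ}
    (hp : 0 < p) : IntegrableOn f (Ioi p) :=
  integrableOn_of_abs_le measurableSet_Ioi (hf.continuousOn.mono (Ioi_subset_Ioi hp.le))
    ((integrableOn_Ioi_rpow_of_lt (by linarith) hp).const_mul _)
    (fun _ hx => hf.abs_le_at hσ₀ hδ hp (le_of_lt hx))

/-- On `(p,∞)` the decaying weight is at most its value at `p`; what remains is the integral of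
`x^(σ-2)`, finite because `σ < 1`. -/
theorem abs_tail_le (hf : TailBound σ δ M f) (hσ₀ : 0 < σ) (hσ₁ : σ < 1) (hδ : 0 < δ) {p : ℝ}
    (hp : 0 < p) :
    |∫ x in Ioi p, f x| ≤ M / (1 - σ) * (p ^ (σ - 1) * (1 + p) ^ (-(δ + σ))) := by
  have h := abs_integral_le_of_abs_le measurableSet_Ioi
    ((integrableOn_Ioi_rpow_of_lt (a := σ - 2) (by linarith) hp).const_mul
      (M * (1 + p) ^ (-(δ + σ)))) (fun x hx => hf.abs_le_at hσ₀ hδ hp (le_of_lt hx))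
  rw [integral_const_mul, integral_Ioi_rpow_of_lt (by linarith) hp] at h
  refine h.trans (le_of_eq ?_)
  rw [show σ - 2 + 1 = -(1 - σ) by ring, show σ - 1 = -(1 - σ) by ring, neg_div_neg_eq]
  ring

theorem hasDerivAt_tail (hf : TailBound σ δ M f) (hσ₀ : 0 < σ) (hσ₁ : σ < 1) (hδ : 0 < δ) {p : ℝ}
    (hp : 0 < p) : HasDerivAt (fun p => ∫ x in Ioi p, f x) (-f p) p :=
  hasDerivAt_integral_Ioi hf.continuousOn (fun _ ha => hf.integrableOn_Ioi hσ₀ hσ₁ hδ ha) hp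

theorem continuousOn_tail (hf : TailBound σ δ M f) (hσ₀ : 0 < σ) (hσ₁ : σ < 1) (hδ : 0 < δ) :
    ContinuousOn (fun p => ∫ x in Ioi p, f x) (Ioi 0) := fun _ hp =>
  (hf.hasDerivAt_tail hσ₀ hσ₁ hδ hp).continuousAt.continuousWithinAt

theorem integrableOn_beta_tail (hσ₀ : 0 < σ) (hδ : 0 < δ) :
    IntegrableOn (fun p : ℝ => p ^ (σ - 1) * (1 + p) ^ (-(δ + σ))) (Ioi 0) := by
  rw [add_comm δ σ]; exact integrableOn_beta hσ₀ hδ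

theorem integrableOn_tail (hf : TailBound σ δ M f) (hσ₀ : 0 < σ) (hσ₁ : σ < 1) (hδ : 0 < δ) :
    IntegrableOn (fun p => ∫ x in Ioi p, f x) (Ioi 0) :=
  integrableOn_of_abs_le measurableSet_Ioi (hf.continuousOn_tail hσ₀ hσ₁ hδ)
    ((integrableOn_beta_tail hσ₀ hδ).const_mul _) (fun _ hp => hf.abs_tail_le hσ₀ hσ₁ hδ hp)

theorem hasDerivAt_tail_tail (hf : TailBound σ δ M f) (hσ₀ : 0 < σ) (hσ₁ : σ < 1) (hδ : 0 < δ)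
    {q : ℝ} (hq : 0 < q) :
    HasDerivAt (fun q => ∫ p in Ioi q, ∫ x in Ioi p, f x) (-∫ x in Ioi q, f x) q :=
  hasDerivAt_integral_Ioi (hf.continuousOn_tail hσ₀ hσ₁ hδ)
    (fun _ ha => (hf.integrableOn_tail hσ₀ hσ₁ hδ).mono_set (Ioi_subset_Ioi (le_of_lt ha))) hq

/-- Continuity reaches `0` because the first tail integral is integrable over all of `(0,∞)`. -/
theorem continuousOn_tail_tail (hf : TailBound σ δ M f) (hσ₀ : 0 < σ) (hσ₁ : σ < 1)
    (hδ : 0 < δ) : ContinuousOn (fun q => ∫ p in Ioi q, ∫ x in Ioi p, f x) (Ici 0) :=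
  (hf.integrableOn_tail hσ₀ hσ₁ hδ).continuousOn_Ici_primitive_Ioi

theorem deriv_tail_tail (hf : TailBound σ δ M f) (hσ₀ : 0 < σ) (hσ₁ : σ < 1) (hδ : 0 < δ) :
    EqOn (deriv (fun q => ∫ p in Ioi q, ∫ x in Ioi p, f x)) (fun q => -∫ x in Ioi q, f x)
      (Ioi 0) := fun _ hq => (hf.hasDerivAt_tail_tail hσ₀ hσ₁ hδ hq).deriv

theorem deriv_deriv_tail_tail (hf : TailBound σ δ M f) (hσ₀ : 0 < σ) (hσ₁ : σ < 1) (hδ : 0 < δ) :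
    EqOn (deriv (deriv (fun q => ∫ p in Ioi q, ∫ x in Ioi p, f x))) f (Ioi 0) := by
  intro q hq
  have h1 : deriv (fun q => ∫ p in Ioi q, ∫ x in Ioi p, f x) =ᶠ[𝓝 q]
      fun q => -∫ x in Ioi q, f x :=
    (hf.deriv_tail_tail hσ₀ hσ₁ hδ).eventuallyEq_of_mem (Ioi_mem_nhds hq)
  rw [h1.deriv_eq, (hf.hasDerivAt_tail hσ₀ hσ₁ hδ hq).fun_neg.deriv, neg_neg]

theorem contDiffOn_tail_tail (hf : TailBound σ δ M f) (hσ₀ : 0 < σ) (hσ₁ : σ < 1) (hδ : 0 < δ) :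
    ContDiffOn ℝ 2 (fun q => ∫ p in Ioi q, ∫ x in Ioi p, f x) (Ioi 0) := by
  rw [← one_add_one_eq_two, contDiffOn_succ_iff_deriv_of_isOpen isOpen_Ioi]
  refine ⟨fun q hq => (hf.hasDerivAt_tail_tail hσ₀ hσ₁ hδ
    hq).differentiableAt.differentiableWithinAt, by simp, ?_⟩
  refine ContDiffOn.congr (f := fun q => -∫ x in Ioi q, f x) ?_ (hf.deriv_tail_tail hσ₀ hσ₁ hδ)
  rw [← zero_add (1 : WithTop ℕ∞), contDiffOn_succ_iff_deriv_of_isOpen isOpen_Ioi]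
  refine ⟨fun q hq => (hf.hasDerivAt_tail hσ₀ hσ₁ hδ
    hq).neg.differentiableAt.differentiableWithinAt, by simp, ?_⟩
  rw [contDiffOn_zero]
  refine hf.continuousOn.congr fun q hq => ?_
  rw [(hf.hasDerivAt_tail hσ₀ hσ₁ hδ hq).fun_neg.deriv, neg_neg]

/-- For `q ≤ 1` the whole beta integral is a bound; for `q ≥ 1` the integrand is at most `p^(-δ-1)`,
whose tail is `q^(-δ)/δ`. The factor `2^δ` converts `1` and `q^(-δ)` into `(1+q)^(-δ)`. -/
theorem abs_tail_tail_le (hf : TailBound σ δ M f) (hσ₀ : 0 < σ) (hσ₁ : σ < 1) (hδ : 0 < δ) {q : ℝ}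
    (hq : 0 < q) :
    |∫ p in Ioi q, ∫ x in Ioi p, f x| ≤
      M * ((betaInt σ δ + 1 / δ) * 2 ^ δ / (1 - σ)) * (1 + q) ^ (-δ) := by
  have hM := hf.nonneg
  have hσ : 0 < 1 - σ := by linarith
  have hb := betaInt_nonneg σ δ
  have hi := integrableOn_beta_tail hσ₀ hδ
  have hiq := hi.mono_set (Ioi_subset_Ioi hq.le)
  have h1 := abs_integral_le_of_abs_le measurableSet_Ioi (hiq.const_mul (M / (1 - σ)))
    (fun p hp => hf.abs_tail_le hσ₀ hσ₁ hδ (hq.trans hp))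
  rw [integral_const_mul] at h1
  have h22 : (2 : ℝ) ^ δ * 2 ^ (-δ) = 1 := by rw [← Real.rpow_add two_pos]; simp
  have h2 : ∫ p in Ioi q, p ^ (σ - 1) * (1 + p) ^ (-(δ + σ)) ≤
      (betaInt σ δ + 1 / δ) * (2 ^ δ * (1 + q) ^ (-δ)) := by
    rcases le_total q 1 with hq1 | hq1
    · have h3 : ∫ p in Ioi q, p ^ (σ - 1) * (1 + p) ^ (-(δ + σ)) ≤ betaInt σ δ := by
        rw [betaInt, add_comm δ σ] at *
        refine setIntegral_mono_set hi ?_ (Ioi_subset_Ioi hq.le).eventuallyLE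
        filter_upwards [ae_restrict_mem measurableSet_Ioi] with p hp
        have hp : 0 < p := hp
        simp only [Pi.zero_apply]
        positivity
      have h4 : 1 ≤ (2 : ℝ) ^ δ * (1 + q) ^ (-δ) := by
        rw [← h22]
        refine mul_le_mul_of_nonneg_left ?_ (by positivity)
        exact Real.rpow_le_rpow_of_nonpos (by linarith) (by linarith) (by linarith)
      have h5 : 0 < 1 / δ := by positivity
      nlinarith
    · have h3 : ∫ p in Ioi q, p ^ (σ - 1) * (1 + p) ^ (-(δ + σ)) ≤ ∫ p in Ioi q, p ^ (-δ - 1) := by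
        refine setIntegral_mono_on hiq (integrableOn_Ioi_rpow_of_lt (by linarith) hq)
          measurableSet_Ioi fun p hp => ?_
        have hp : 0 < p := hq.trans hp
        calc p ^ (σ - 1) * (1 + p) ^ (-(δ + σ)) ≤ p ^ (σ - 1) * p ^ (-(δ + σ)) :=
              mul_le_mul_of_nonneg_left (one_add_rpow_neg_le hp (by linarith) le_rfl)
                (by positivity)
          _ = _ := by rw [← Real.rpow_add hp]; congr 1; ring
      rw [integral_Ioi_rpow_of_lt (by linarith) hq, sub_add_cancel, neg_div_neg_eq] at h3
      have h4 : q ^ (-δ) ≤ 2 ^ δ * (1 + q) ^ (-δ) := by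
        have h5 : (q * 2) ^ (-δ) ≤ (1 + q) ^ (-δ) :=
          Real.rpow_le_rpow_of_nonpos (by linarith) (by linarith) (by linarith)
        rw [Real.mul_rpow hq.le zero_le_two] at h5
        calc q ^ (-δ) = 2 ^ δ * (q ^ (-δ) * 2 ^ (-δ)) := by
              linear_combination (-q ^ (-δ)) * h22
          _ ≤ _ := by gcongr
      calc _ ≤ 1 / δ * q ^ (-δ) := h3.trans (le_of_eq (by ring))
        _ ≤ (betaInt σ δ + 1 / δ) * (2 ^ δ * (1 + q) ^ (-δ)) := by
            refine mul_le_mul ?_ h4 (by positivity) (by positivity)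
            linarith
  refine h1.trans ((mul_le_mul_of_nonneg_left h2 (by positivity)).trans (le_of_eq ?_))
  ring

end TailBound

/-! ### The bilinear form -/

/-- The three summands of the constant belong to the orders zero, one and two, with `σ = ρ+μ`; at
order two the function is `f` itself. -/
theorem lapNorm_tail_tail_le {ρ μ χ M : ℝ} {f : ℝ → ℝ} (hf : TailBound (ρ + μ) χ M f)
    (hσ₀ : 0 < ρ + μ) (hσ₁ : ρ + μ < 1) (hχ : 0 < χ) :
    lapNorm ρ 2 μ χ (fun q => ∫ p in Ioi q, ∫ x in Ioi p, f x) ≤ ENNReal.ofReal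
      (((betaInt (ρ + μ) χ + 1 / χ) * 2 ^ χ / (1 - (ρ + μ)) + (1 / (1 - (ρ + μ)) + 1)) * M) := by
  have hM := hf.nonneg
  have h1 : 0 < 1 - (ρ + μ) := by linarith
  have hb := betaInt_nonneg (ρ + μ) χ
  rw [lapNorm_two, add_mul, add_mul (1 / (1 - (ρ + μ))) 1 M,
    ENNReal.ofReal_add (by positivity) (by positivity),
    ENNReal.ofReal_add (by positivity) (by positivity)]
  refine add_le_add (lapSeminorm_le_of_le fun x hx => ?_) (add_le_add
    (lapSeminorm_le_of_le fun x hx => ?_) (lapSeminorm_le_of_le fun x hx => ?_))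
  · have := hf.abs_tail_tail_le hσ₀ hσ₁ hχ hx
    rw [iteratedDeriv_zero]
    refine this.trans (le_of_eq ?_)
    -- At order zero the norm has `-ρ` in place of `μ`, so the power of `x` disappears.
    simp only [CharP.cast_eq_zero, add_neg_cancel, sub_zero, Real.rpow_zero, neg_add_cancel_right]
    ring
  · rw [iteratedDeriv_one, hf.deriv_tail_tail hσ₀ hσ₁ hχ hx, abs_neg]
    refine (hf.abs_tail_le hσ₀ hσ₁ hχ hx).trans (le_of_eq ?_)
    rw [Nat.cast_one, show χ + (ρ + μ) = χ + μ + ρ by ring]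
    ring
  · rw [iteratedDeriv_succ, iteratedDeriv_one, hf.deriv_deriv_tail_tail hσ₀ hσ₁ hχ hx]
    refine (hf.bound x hx).trans (le_of_eq ?_)
    rw [show χ + (ρ + μ) = χ + μ + ρ by ring, one_mul]
    norm_num

/-- Absolute convergence is essential here, as a divergent Bochner integral takes the value `0` and
would break additivity. -/
theorem formBW_linear {Wc : ℂ → ℂ} {G H G₁ H₁ G₂ H₂ : ℝ → ℝ} {a b : ℝ}
    (h₁ : BWConverges Wc G₁ H₁) (h₂ : BWConverges Wc G₂ H₂)
    (hN : ∀ r > 0, formN Wc G H r = a * formN Wc G₁ H₁ r + b * formN Wc G₂ H₂ r) {q : ℝ}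
    (hq : 0 ≤ q) : formBW Wc G H q = a * formBW Wc G₁ H₁ q + b * formBW Wc G₂ H₂ q := by
  have hP : ∀ p > 0, ∫ r in Ioi p, formN Wc G H r =
      a * (∫ r in Ioi p, formN Wc G₁ H₁ r) + b * ∫ r in Ioi p, formN Wc G₂ H₂ r := by
    intro p hp
    rw [← integral_const_mul, ← integral_const_mul,
      ← integral_add ((h₁.2.1 p hp).const_mul a) ((h₂.2.1 p hp).const_mul b)]
    exact setIntegral_congr_fun measurableSet_Ioi fun r hr => hN r (hp.trans hr)
  have hs : Ioi q ⊆ Ioi 0 := Ioi_subset_Ioi hq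
  rw [formBW, formBW, formBW, ← integral_const_mul, ← integral_const_mul,
    ← integral_add (Integrable.const_mul (h₁.2.2.mono_set hs) a)
      (Integrable.const_mul (h₂.2.2.mono_set hs) b)]
  exact setIntegral_congr_fun measurableSet_Ioi fun p hp => hP p (hq.trans_lt hp)

section

variable {ρ θ g₁ g₂ : ℝ} {Wc : ℂ → ℂ} {G₁ G₂ H : ℝ → ℝ}

theorem deriv_linear (h₁ : LapBound ρ θ g₁ G₁) (h₂ : LapBound ρ θ g₂ G₂) (a b : ℝ) {x : ℝ}
    (hx : 0 < x) :
    deriv (fun x => a * G₁ x + b * G₂ x) x = a * deriv G₁ x + b * deriv G₂ x :=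
  (((h₁.hasDerivAt x hx).const_mul a).fun_add ((h₂.hasDerivAt x hx).const_mul b)).deriv

theorem iteratedDeriv_two_linear (h₁ : LapBound ρ θ g₁ G₁) (h₂ : LapBound ρ θ g₂ G₂) (a b : ℝ)
    {x : ℝ} (hx : 0 < x) : iteratedDeriv 2 (fun x => a * G₁ x + b * G₂ x) x =
      a * iteratedDeriv 2 G₁ x + b * iteratedDeriv 2 G₂ x := by
  have e : deriv (fun x => a * G₁ x + b * G₂ x) =ᶠ[𝓝 x]
      fun x => a * deriv G₁ x + b * deriv G₂ x := by
    filter_upwards [Ioi_mem_nhds hx] with y hy using deriv_linear h₁ h₂ a b hy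
  rw [iteratedDeriv_succ, iteratedDeriv_one, e.deriv_eq]
  exact (((h₁.hasDerivAt_deriv x hx).const_mul a).fun_add
    ((h₂.hasDerivAt_deriv x hx).const_mul b)).deriv

theorem formN_linear_left (h₁ : LapBound ρ θ g₁ G₁) (h₂ : LapBound ρ θ g₂ G₂)
    (hc₁ : BWConverges Wc G₁ H) (hc₂ : BWConverges Wc G₂ H) (a b : ℝ) {r : ℝ} (hr : 0 < r) :
    formN Wc (fun x => a * G₁ x + b * G₂ x) H r = a * formN Wc G₁ H r + b * formN Wc G₂ H r := by
  have e₁ := kerIntegral_linear (F := integrand₁ (fun x => a * G₁ x + b * G₂ x) H r) a b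
    (hc₁.1 r hr).1 (hc₂.1 r hr).1 fun ξ hξ η hη => by
      rw [integrand₁, iteratedDeriv_two_linear h₁ h₂ a b (by linarith), integrand₁, integrand₁]
      ring
  have e₂ := kerIntegral_linear (F := integrand₂ (fun x => a * G₁ x + b * G₂ x) H r) a b
    (hc₁.1 r hr).2 (hc₂.1 r hr).2 fun ξ hξ η hη => by
      rw [integrand₂, deriv_linear h₁ h₂ a b (by linarith), integrand₂, integrand₂]
      ring
  simp only [formN, formN₁, formN₂, e₁, e₂]
  ring

theorem formN_linear_right (h₁ : LapBound ρ θ g₁ G₁) (h₂ : LapBound ρ θ g₂ G₂)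
    (hc₁ : BWConverges Wc H G₁) (hc₂ : BWConverges Wc H G₂) (a b : ℝ) {r : ℝ} (hr : 0 < r) :
    formN Wc H (fun x => a * G₁ x + b * G₂ x) r = a * formN Wc H G₁ r + b * formN Wc H G₂ r := by
  have e₁ := kerIntegral_linear (F := integrand₁ H (fun x => a * G₁ x + b * G₂ x) r) a b
    (hc₁.1 r hr).1 (hc₂.1 r hr).1 fun ξ hξ η hη => by
      simp only [integrand₁]
      ring
  have e₂ := kerIntegral_linear (F := integrand₂ H (fun x => a * G₁ x + b * G₂ x) r) a b
    (hc₁.1 r hr).2 (hc₂.1 r hr).2 fun ξ hξ η hη => by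
      rw [integrand₂, deriv_linear h₁ h₂ a b hη, deriv_linear h₁ h₂ a b (by linarith),
        integrand₂, integrand₂]
      ring
  simp only [formN, formN₁, formN₂, e₁, e₂]
  ring

end

end FatTail

theorem proposition3p2 (α ρ θ μ : ℝ) (hα₀ : 0 < α) (hα₁ : α < 1) (hρ₀ : 0 < ρ) (hρ₁ : ρ < 1)
    (hθ₀ : α < θ) (hθ₁ : θ < ρ) (hμ₀ : 0 ≤ μ) (hμ₁ : μ < min ρ (1 - ρ))
    (W : ℝ → ℝ → ℝ) (Wc : ℂ → ℂ) (hW : FatTail.IsPerturbationKernel α W Wc) :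
    -- the map is well defined on the space, with values in the space with less decay
    (∀ G ∈ FatTail.lapSpace ρ 2 0 θ, ∀ H ∈ FatTail.lapSpace ρ 2 0 θ,
      FatTail.BWConverges Wc G H ∧
      FatTail.formBW Wc G H ∈ FatTail.lapSpace ρ 2 μ (θ - α)) ∧
    -- the map is bilinear
    (∀ G₁ ∈ FatTail.lapSpace ρ 2 0 θ, ∀ G₂ ∈ FatTail.lapSpace ρ 2 0 θ,
      ∀ H ∈ FatTail.lapSpace ρ 2 0 θ, ∀ a b : ℝ, ∀ q : ℝ, 0 ≤ q →
      FatTail.formBW Wc (fun x => a * G₁ x + b * G₂ x) H q =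
        a * FatTail.formBW Wc G₁ H q + b * FatTail.formBW Wc G₂ H q ∧
      FatTail.formBW Wc H (fun x => a * G₁ x + b * G₂ x) q =
        a * FatTail.formBW Wc H G₁ q + b * FatTail.formBW Wc H G₂ q) ∧
    -- the map is continuous
    ∃ C : ℝ, 0 < C ∧
      ∀ G ∈ FatTail.lapSpace ρ 2 0 θ, ∀ H ∈ FatTail.lapSpace ρ 2 0 θ,
        FatTail.lapNorm ρ 2 μ (θ - α) (FatTail.formBW Wc G H) ≤
          ENNReal.ofReal C * FatTail.lapNorm ρ 2 0 θ G * FatTail.lapNorm ρ 2 0 θ H := by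
  obtain ⟨C, hK⟩ := hW.exists_kernelBound hα₀ hα₁
  have hμρ : μ < ρ := hμ₁.trans_le (min_le_left _ _)
  have hμρ' : μ < 1 - ρ := hμ₁.trans_le (min_le_right _ _)
  have hσ₀ : 0 < ρ + μ := by linarith
  have hσ₁ : ρ + μ < 1 := by linarith
  have hδ : 0 < θ - α := by linarith
  obtain ⟨A, hA, hN⟩ := FatTail.exists_abs_formN_le hK hα₀ hα₁ hθ₀ hθ₁ hρ₁ hμ₀ hμρ hμρ'
  have htail : ∀ G ∈ FatTail.lapSpace ρ 2 0 θ, ∀ H ∈ FatTail.lapSpace ρ 2 0 θ,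
      FatTail.TailBound (ρ + μ) (θ - α)
        (A * ((FatTail.lapNorm ρ 2 0 θ G).toReal * (FatTail.lapNorm ρ 2 0 θ H).toReal))
        (FatTail.formN Wc G H) := fun G hG H hH =>
    ⟨by positivity, FatTail.continuousOn_formN hK hα₀ hα₁ hθ₀ hθ₁ hρ₁ (.of_mem hG) (.of_mem hH),
      fun r hr => (hN _ _ _ _ (.of_mem hG) (.of_mem hH) r hr).trans (le_of_eq (by ring_nf))⟩
  have hconv : ∀ G ∈ FatTail.lapSpace ρ 2 0 θ, ∀ H ∈ FatTail.lapSpace ρ 2 0 θ,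
      FatTail.BWConverges Wc G H := fun G hG H hH =>
    ⟨fun r hr => ⟨FatTail.kerIntegrable_integrand₁ hK hα₀ hα₁ hρ₀ hθ₀ (by linarith) (.of_mem hG)
        (.of_mem hH) hr, FatTail.kerIntegrable_integrand₂ hK hα₀ hα₁ (by linarith) hρ₁
        (by linarith) (.of_mem hG) (.of_mem hH) hr⟩,
      fun p hp => (htail G hG H hH).integrableOn_Ioi hσ₀ hσ₁ hδ hp,
      (htail G hG H hH).integrableOn_tail hσ₀ hσ₁ hδ⟩
  have hnorm := fun G hG H hH =>
    FatTail.lapNorm_tail_tail_le (htail G hG H hH) hσ₀ hσ₁ hδ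
  refine ⟨fun G hG H hH => ⟨hconv G hG H hH, (htail G hG H hH).contDiffOn_tail_tail hσ₀ hσ₁ hδ,
      (htail G hG H hH).continuousOn_tail_tail hσ₀ hσ₁ hδ,
      (hnorm G hG H hH).trans_lt ENNReal.ofReal_lt_top⟩,
    fun G₁ h₁ G₂ h₂ H hH a b q hq => ⟨?_, ?_⟩, ?_⟩
  · exact FatTail.formBW_linear (hconv G₁ h₁ H hH) (hconv G₂ h₂ H hH)
      (fun r hr => FatTail.formN_linear_left (.of_mem h₁) (.of_mem h₂) (hconv G₁ h₁ H hH)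
        (hconv G₂ h₂ H hH) a b hr) hq
  · exact FatTail.formBW_linear (hconv H hH G₁ h₁) (hconv H hH G₂ h₂)
      (fun r hr => FatTail.formN_linear_right (.of_mem h₁) (.of_mem h₂) (hconv H hH G₁ h₁)
        (hconv H hH G₂ h₂) a b hr) hq
  · set D := (FatTail.betaInt (ρ + μ) (θ - α) + 1 / (θ - α)) * 2 ^ (θ - α) / (1 - (ρ + μ)) +
      (1 / (1 - (ρ + μ)) + 1) with hD
    have hD0 : 0 ≤ D := by
      have h1 := FatTail.betaInt_nonneg (ρ + μ) (θ - α)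
      have h2 : 0 < 1 - (ρ + μ) := by linarith
      positivity
    -- The summand `1` makes the constant strictly positive.
    refine ⟨D * A + 1, by positivity, fun G hG H hH => (hnorm G hG H hH).trans ?_⟩
    rw [← ENNReal.ofReal_toReal hG.2.2.ne, ← ENNReal.ofReal_toReal hH.2.2.ne,
      ← ENNReal.ofReal_mul (by positivity), ← ENNReal.ofReal_mul (by positivity)]
    refine ENNReal.ofReal_le_ofReal ?_
    rw [ENNReal.toReal_ofReal ENNReal.toReal_nonneg, ENNReal.toReal_ofReal ENNReal.toReal_nonneg]
    have h3 : 0 ≤ (FatTail.lapNorm ρ 2 0 θ G).toReal * (FatTail.lapNorm ρ 2 0 θ H).toReal := by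
      positivity
    nlinarith
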